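/- A Markov decision process (MDP) $\mathcal M$ consists of a countable set $S$ of states, partitioned into controlled and random states, a transition relation $\longrightarrow\ \subseteq S\times S$ under which every state has at least one (possibly infinitely many) successors, and, for each random state $s$, a probability distribution $P(s)$ over the successors of $s$. It is acyclic if the directed graph $(S,\longrightarrow)$ has no cycle. A strategy $\sigma$ assigns to every finite history $s_0\cdots s_n$ ending in a controlled state $s_n$ a probability distribution over the successors of $s_n$. It is deterministic if all these distributions are Dirac, memoryless if they depend only on $s_n$, and Markov if they depend only on $s_n$ and $n$; an MD strategy is a memoryless deterministic one. Together with an initial state $s$, a strategy $\sigma$ induces a probability measure $\mathbb P_{s,\sigma}$ on $S^\omega$. For an objective $\varphi\subseteq S^\omega$, the strategy $\sigma$ is optimal from $s$ if $\mathbb P_{s,\sigma}(\varphi)=\sup_{\sigma'}\mathbb P_{s,\sigma'}(\varphi)$, where $\sigma'$ ranges over all strategies. Theorem. Let $\mathcal M$ be an MDP with a coloring $\mathit{Col}:S\to\{0,1,2\}$, and let $\varphi$ be the parity objective, that is, the set of infinite sequences of states such that the largest color that occurs infinitely often is even. Let $S_{\mathit{opt}}\subseteq S$ be the set of states from which there is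 an optimal strategy for $\varphi$. 1. If $\mathcal M$ is acyclic, then there exists a single MD strategy that is optimal for $\varphi$ from every state in $S_{\mathit{opt}}$. 2. In general (without assuming acyclicity), there exists a single deterministic Markov strategy that is optimal for $\varphi$ from every state in $S_{\mathit{opt}}$. -/

import Mathlib

open MeasureTheory ProbabilityTheory Filter
open scoped ENNReal

/-- A Markov decision process with state space `S`. The states in `controlled` belong to the
player, all other states are random. Every state has a successor, and the distribution attached
to a random state is a distribution over its successors. -/
structure MDP (S : Type*) where
  /-- the controlled states; the random states are the complement -/
  controlled : Set S
  /-- the transition relation -/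
  trans : S → S → Prop
  /-- the probability function on the random states -/
  prob : (controlledᶜ : Set S) → PMF S
  exists_succ : ∀ s, ∃ t, trans s t
  prob_support : ∀ s, ∀ t ∈ (prob s).support, trans s t

namespace MDP

variable {S : Type*}

/-- The underlying directed graph has no cycle (in particular no loop). -/
def Acyclic (M : MDP S) : Prop :=
  ∀ s, ¬ Relation.TransGen M.trans s s

/-- A (history-dependent, randomized) strategy: a history `w s` that ends in a controlled state
`s`, where `w` is the finite sequence of the states visited before, is mapped to a
distribution over the successors of `s`. -/
structure Strategy (M : MDP S) where
  act : List S → M.controlled → PMF S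
  act_support : ∀ w s, ∀ t ∈ (act w s).support, M.trans s t

open Classical in
/-- The strategy, extended to histories that end in a random state by the probability function
of the MDP: the distribution of the next state after the history `w s`. -/
noncomputable def Strategy.step {M : MDP S} (σ : M.Strategy) (w : List S) (s : S) : PMF S :=
  if h : s ∈ M.controlled then σ.act w ⟨s, h⟩ else M.prob ⟨s, h⟩

section Probability

variable [Countable S] [MeasurableSpace S] [DiscreteMeasurableSpace S]

/-- The transition kernel of step `n`: given the states `x 0, …, x n`, the distribution of the
next state. -/
noncomputable def Strategy.kernel {M : MDP S} (σ : M.Strategy) (n : ℕ) :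
    Kernel (Π _ : Finset.Iic n, S) S where
  toFun x := (σ.step (List.ofFn fun i : Fin n => x ⟨i, Finset.mem_Iic.2 i.2.le⟩)
    (x ⟨n, Finset.mem_Iic.2 le_rfl⟩)).toMeasure
  measurable' := measurable_of_countable _

instance Strategy.isMarkovKernel_kernel {M : MDP S} (σ : M.Strategy) (n : ℕ) :
    IsMarkovKernel (σ.kernel n) :=
  ⟨fun _ => PMF.toMeasure.isProbabilityMeasure _⟩

/-- The probability measure on infinite sequences of states that is induced by the strategy `σ`
and the initial state `s₀` (the Ionescu-Tulcea extension of the probabilities of the cylinders).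
It is carried by the runs of the MDP that start in `s₀`. -/
noncomputable def Strategy.runMeasure {M : MDP S} (σ : M.Strategy) (s₀ : S) : Measure (ℕ → S) :=
  Kernel.traj (X := fun _ => S) σ.kernel 0 (fun _ => s₀)

/-- The value of the state `s` for the objective `φ`. -/
noncomputable def value (M : MDP S) (φ : Set (ℕ → S)) (s : S) : ℝ≥0∞ :=
  ⨆ σ : M.Strategy, σ.runMeasure s φ

/-- `σ` is optimal for the objective `φ` from the state `s`. -/
def Strategy.IsOptimalFrom {M : MDP S} (σ : M.Strategy) (φ : Set (ℕ → S)) (s : S) : Prop :=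
  M.value φ s ≤ σ.runMeasure s φ

/-- The set of states from which there is an optimal strategy for `φ`. -/
def optStates (M : MDP S) (φ : Set (ℕ → S)) : Set S :=
  {s | ∃ σ : M.Strategy, σ.IsOptimalFrom φ s}

end Probability

/-- All choices of the strategy are Dirac distributions. -/
def Strategy.IsDeterministic {M : MDP S} (σ : M.Strategy) : Prop :=
  ∀ w s, ∃ t, σ.act w s = PMF.pure t

/-- The choices of the strategy depend only on the current state. -/
def Strategy.IsMemoryless {M : MDP S} (σ : M.Strategy) : Prop :=
  ∃ u : M.controlled → PMF S, ∀ w s, σ.act w s = u s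

/-- The choices of the strategy depend only on the current state and on the number of steps
taken so far. -/
def Strategy.IsMarkov {M : MDP S} (σ : M.Strategy) : Prop :=
  ∃ u : ℕ → M.controlled → PMF S, ∀ w s, σ.act w s = u w.length s

/-- The parity objective: some even color `i` is seen infinitely often, and from some point on
no color larger than `i` is seen. -/
def parity (col : S → ℕ) : Set (ℕ → S) :=
  {ρ | ∃ i, Even i ∧ (∃ᶠ n in atTop, col (ρ n) = i) ∧ ∀ᶠ n in atTop, col (ρ n) ≤ i}

end MDP

namespace MDP

/-! Part 1 reduces optimal play to almost sure winning by conditioning on the objective `φ`. Call a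
state good if it has positive value and some optimal strategy. In `conditioned`, a good controlled
state keeps only Dirac moves to good states of the same value, and a good random state has its
probabilities multiplied by the value of the successor and divided by its own. The value function is
then a density between the two processes: by `mul_chainLaw_le`, a choice of moves that satisfies `φ`
almost surely in the conditioned process attains the value in the original one.

To win almost surely, let `T` be the states of color 2, `B` those of color 1, and `D` those from
which `B` can be avoided in the conditioned process with value at least 1/2. Under an optimal
strategy, a run of `φ` that misses `T` eventually avoids `B`, and doing so without ever entering `D`
has probability zero. Hence `T ∪ D`, together with the irrelevant bad states, can be reached with
value 1 (`reachValue_conditioned_eq_one`).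

Choices are then fixed state by state. `exists_safe_refinement` makes every state of `D` safe with
probability at least 1/12 whatever is chosen later; `exists_uniform_reach` then makes the target
reachable from everywhere with probability at least 1/4, hence visited infinitely often almost
surely. By a zero-one law (`chainLaw_eq_one`), almost every run from a good state satisfies `φ`.
Acyclicity enters through `exists_potential`: a state is visited at most once, so near-optimal
choices with summable errors lose little in total.

Part 2 applies part 1 to the process that records the time in its states. It is acyclic, and a
memoryless strategy for it is a Markov strategy for the original process. -/

lemma prefixSet_eq_preimage {S : Type*} (x : ℕ → S) (n : ℕ) :
    {ρ : ℕ → S | ∀ i ≤ n, ρ i = x i} =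
      Preorder.frestrictLe (π := fun _ : ℕ => S) n ⁻¹' {Preorder.frestrictLe n x} := by
  ext ρ
  simp only [Set.mem_ofPred_eq, Set.mem_preimage, Set.mem_singleton_iff, funext_iff,
    Preorder.frestrictLe_apply, Subtype.forall, Finset.mem_Iic]

/-- The sequence `s, ρ 0, ρ 1, …`. -/
def consRun {S : Type*} (s : S) (ρ : ℕ → S) : ℕ → S
  | 0 => s
  | n + 1 => ρ n

@[simp] lemma consRun_zero {S : Type*} (s : S) (ρ : ℕ → S) : consRun s ρ 0 = s := rfl

lemma measurable_consRun {S : Type*} [MeasurableSpace S] (s : S) : Measurable (consRun s) := by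
  refine measurable_pi_lambda _ fun n => ?_
  cases n with
  | zero => exact measurable_const
  | succ n => exact measurable_pi_apply n

/-- Every measurable event is approximated by events that depend on finitely many states. -/
lemma exists_dependsOn_symmDiff_lt {S : Type*} [MeasurableSpace S]
    (μ : Measure (ℕ → S)) [IsFiniteMeasure μ] {A : Set (ℕ → S)}
    (hA : MeasurableSet A) {ε : ℝ≥0∞} (hε : 0 < ε) :
    ∃ C : Set (ℕ → S), MeasurableSet C ∧
      (∃ n, ∀ ρ ρ' : ℕ → S, (∀ i < n, ρ i = ρ' i) → ρ ∈ C → ρ' ∈ C) ∧ μ (symmDiff C A) < ε := by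
  obtain ⟨C, hC, hlt⟩ := exists_measure_symmDiff_lt_of_generateFrom_isSetRing (μ := μ)
    (isSetRing_measurableCylinders (α := fun _ : ℕ => S))
    ⟨{Set.univ}, Set.countable_singleton _,
      Set.singleton_subset_iff.2 isSetAlgebra_measurableCylinders.univ_mem, by simp⟩
    generateFrom_measurableCylinders.symm hA hε
  rw [measurableCylinders_nat] at hC
  simp only [Set.mem_iUnion, Set.mem_singleton_iff, exists_prop] at hC
  obtain ⟨n, B, hB, rfl⟩ := hC
  refine ⟨_, MeasurableSet.cylinder _ hB, ⟨n + 1, fun ρ ρ' h hρ => ?_⟩, hlt⟩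
  have : (Finset.Iic n).restrict ρ = (Finset.Iic n).restrict ρ' := by
    ext ⟨i, hi⟩
    exact h i (Nat.lt_succ_of_le (Finset.mem_Iic.1 hi))
  rw [mem_cylinder] at hρ ⊢
  rwa [← this]

/-! ### Laws of history-dependent processes, prefix probabilities and the first-step decomposition.
-/

section Runs

variable {S : Type*} [Countable S] [MeasurableSpace S] [DiscreteMeasurableSpace S]

/-- The transition kernel of time `n` of the process in which the state after the history `w s` is
distributed according to `step w s`. -/
noncomputable def historyKernel (step : List S → S → PMF S) (n : ℕ) :
    Kernel (Π _ : Finset.Iic n, S) S where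
  toFun x := (step (List.ofFn fun i : Fin n => x ⟨i, Finset.mem_Iic.2 i.2.le⟩)
    (x ⟨n, Finset.mem_Iic.2 le_rfl⟩)).toMeasure
  measurable' := measurable_of_countable _

instance (step : List S → S → PMF S) (n : ℕ) : IsMarkovKernel (historyKernel step n) :=
  ⟨fun _ => PMF.toMeasure.isProbabilityMeasure _⟩

/-- The law of the process with transition rule `step` that starts in `s`. -/
noncomputable def processLaw (step : List S → S → PMF S) (s : S) : Measure (ℕ → S) :=
  Kernel.traj (X := fun _ => S) (historyKernel step) 0 (fun _ => s)

instance (step : List S → S → PMF S) (s : S) : IsProbabilityMeasure (processLaw step s) := by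
  unfold processLaw; infer_instance

lemma Strategy.runMeasure_eq_processLaw {M : MDP S} (σ : M.Strategy) (s : S) :
    σ.runMeasure s = processLaw σ.step s := rfl

lemma measurableSet_prefixSet (x : ℕ → S) (n : ℕ) :
    MeasurableSet {ρ : ℕ → S | ∀ i ≤ n, ρ i = x i} := by
  rw [prefixSet_eq_preimage]
  exact (MeasurableSet.singleton _).preimage (Preorder.measurable_frestrictLe _)

/-- Probability measures on sequences of states are determined by the prefix sets. -/
lemma ext_of_prefixSet {μ ν : Measure (ℕ → S)} [IsProbabilityMeasure μ] [IsProbabilityMeasure ν]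
    (h : ∀ (x : ℕ → S) n, μ {ρ | ∀ i ≤ n, ρ i = x i} = ν {ρ | ∀ i ≤ n, ρ i = x i}) : μ = ν := by
  refine ext_of_generate_finite (measurableCylinders fun _ : ℕ => S)
    generateFrom_measurableCylinders.symm isPiSystem_measurableCylinders ?_ (by simp)
  intro A hA
  rw [measurableCylinders_nat] at hA
  simp only [Set.mem_iUnion, Set.mem_singleton_iff, exists_prop] at hA
  obtain ⟨n, B, hB, rfl⟩ := hA
  have key : μ.map (Preorder.frestrictLe (π := fun _ : ℕ => S) n) =
      ν.map (Preorder.frestrictLe (π := fun _ : ℕ => S) n) := by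
    refine Measure.ext_of_singleton fun y => ?_
    rcases isEmpty_or_nonempty (ℕ → S) with hE | ⟨⟨z⟩⟩
    · exact (hE.false fun _ => y ⟨n, Finset.mem_Iic.2 le_rfl⟩).elim
    rw [Measure.map_apply (Preorder.measurable_frestrictLe _) (MeasurableSet.singleton _),
      Measure.map_apply (Preorder.measurable_frestrictLe _) (MeasurableSet.singleton _)]
    have hy : y = Preorder.frestrictLe n
        (fun i => if hi : i ≤ n then y ⟨i, Finset.mem_Iic.2 hi⟩ else z i) := by
      ext ⟨i, hi⟩
      simp [Finset.mem_Iic.1 hi]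
    rw [hy, ← prefixSet_eq_preimage]
    exact h _ n
  have := congrArg (fun m => m B) key
  rwa [Measure.map_apply (Preorder.measurable_frestrictLe n) hB,
    Measure.map_apply (Preorder.measurable_frestrictLe n) hB] at this

lemma processLaw_prefixSet_zero (step : List S → S → PMF S) (s : S) (x : ℕ → S)
    [Decidable (x 0 = s)] :
    processLaw step s {ρ | ∀ i ≤ 0, ρ i = x i} = if x 0 = s then 1 else 0 := by
  rw [prefixSet_eq_preimage, ← Measure.map_apply (Preorder.measurable_frestrictLe _)
    (MeasurableSet.singleton _), processLaw, Kernel.traj_map_frestrictLe_apply,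
    Kernel.partialTraj_self, Kernel.id_apply, Measure.dirac_apply' _ (MeasurableSet.singleton _)]
  have : (fun _ : Finset.Iic 0 => s) = Preorder.frestrictLe (π := fun _ : ℕ => S) 0 x ↔
      x 0 = s := by
    simp only [funext_iff, Preorder.frestrictLe_apply, Subtype.forall, Finset.mem_Iic, Nat.le_zero,
      forall_eq, eq_comm]
  split_ifs with h
  · rw [Set.indicator_of_mem (Set.mem_singleton_iff.2 (this.2 h)), Pi.one_apply]
  · rw [Set.indicator_of_notMem fun h' => h (this.1 (Set.mem_singleton_iff.1 h'))]

lemma processLaw_prefixSet_succ (step : List S → S → PMF S) (s : S) (x : ℕ → S) (n : ℕ) :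
    processLaw step s {ρ | ∀ i ≤ n + 1, ρ i = x i} =
      processLaw step s {ρ | ∀ i ≤ n, ρ i = x i} *
        step (List.ofFn fun i : Fin n => x i) (x n) (x (n + 1)) := by
  have h1 : {ρ : ℕ → S | ∀ i ≤ n + 1, ρ i = x i} =
      (fun ρ : ℕ → S => (Preorder.frestrictLe (π := fun _ : ℕ => S) n ρ, ρ (n + 1))) ⁻¹'
        ({Preorder.frestrictLe n x} ×ˢ {x (n + 1)}) := by
    ext ρ
    simp only [Set.mem_ofPred_eq, Set.mem_preimage, Set.mem_prod, Set.mem_singleton_iff, funext_iff,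
      Preorder.frestrictLe_apply, Subtype.forall, Finset.mem_Iic]
    constructor
    · exact fun h => ⟨fun i hi => h i (by omega), h _ le_rfl⟩
    · rintro ⟨h, h'⟩ i hi
      rcases Nat.le_succ_iff.1 hi with hi | rfl
      exacts [h i hi, h']
  have hm : Measurable
      (fun ρ : ℕ → S => (Preorder.frestrictLe (π := fun _ : ℕ => S) n ρ, ρ (n + 1))) := by
    fun_prop
  rw [h1, ← Measure.map_apply hm ((MeasurableSet.singleton _).prod (MeasurableSet.singleton _)),
    processLaw, ← Kernel.partialTraj_compProd_eq_map_traj (Nat.zero_le n),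
    Measure.compProd_apply_prod (MeasurableSet.singleton _) (MeasurableSet.singleton _),
    lintegral_singleton, prefixSet_eq_preimage,
    ← Measure.map_apply (Preorder.measurable_frestrictLe _) (MeasurableSet.singleton _),
    Kernel.traj_map_frestrictLe_apply, mul_comm]
  congr 1
  exact PMF.toMeasure_apply_singleton _ _ (MeasurableSet.singleton _)

open Classical in
/-- The law of a process is characterized by the probabilities of the prefix sets. -/
lemma eq_processLaw {step : List S → S → PMF S} {s : S} {μ : Measure (ℕ → S)}
    [IsProbabilityMeasure μ]
    (h0 : ∀ x : ℕ → S, μ {ρ | ∀ i ≤ 0, ρ i = x i} = if x 0 = s then 1 else 0)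
    (hs : ∀ (x : ℕ → S) n, x 0 = s → μ {ρ | ∀ i ≤ n + 1, ρ i = x i} =
      μ {ρ | ∀ i ≤ n, ρ i = x i} * step (List.ofFn fun i : Fin n => x i) (x n) (x (n + 1))) :
    μ = processLaw step s := by
  refine ext_of_prefixSet fun x n => ?_
  induction n with
  | zero => rw [h0, processLaw_prefixSet_zero]
  | succ n ih =>
    by_cases hx : x 0 = s
    · rw [hs x n hx, processLaw_prefixSet_succ, ih]
    · have hsub : {ρ : ℕ → S | ∀ i ≤ n + 1, ρ i = x i} ⊆ {ρ | ∀ i ≤ 0, ρ i = x i} :=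
        fun ρ h i hi => h i (by omega)
      rw [measure_mono_null hsub (by rw [h0, if_neg hx]),
        measure_mono_null hsub (by rw [processLaw_prefixSet_zero, if_neg hx])]

/-- The law of a process depends only on the transitions after histories that start in the initial
state. -/
lemma processLaw_congr {step step' : List S → S → PMF S} {s : S}
    (h : ∀ w u, (w ++ [u]).head? = some s → step w u = step' w u) :
    processLaw step s = processLaw step' s := by
  classical
  refine eq_processLaw (fun x => processLaw_prefixSet_zero _ _ _) fun x n hx => ?_
  rw [processLaw_prefixSet_succ, h]
  cases n with
  | zero => simp [hx]
  | succ n => simp [List.ofFn_succ, hx]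

/-- The decomposition of the law of a process according to the first transition. -/
lemma processLaw_apply (step : List S → S → PMF S) (s : S) {A : Set (ℕ → S)}
    (hA : MeasurableSet A) :
    processLaw step s A =
      ∑' t, step [] s t * processLaw (fun w => step (s :: w)) t (consRun s ⁻¹' A) := by
  classical
  -- The mixture, over the first successor `t`, of the laws of `s` followed by a run from `t`. It is
  -- identified with the process law through its prefix probabilities.
  set μ : Measure (ℕ → S) := Measure.sum fun t =>
    step [] s t • (processLaw (fun w => step (s :: w)) t).map (consRun s) with hμ
  have happ : ∀ B : Set (ℕ → S), MeasurableSet B → μ B =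
      ∑' t, step [] s t * processLaw (fun w => step (s :: w)) t (consRun s ⁻¹' B) := by
    intro B hB
    rw [hμ, Measure.sum_apply _ hB]
    refine tsum_congr fun t => ?_
    rw [Measure.smul_apply, Measure.map_apply (measurable_consRun s) hB, smul_eq_mul]
  have hP : IsProbabilityMeasure μ := ⟨by rw [happ _ MeasurableSet.univ]; simp [PMF.tsum_coe]⟩
  have hcons : ∀ (x : ℕ → S) n, x 0 = s → consRun s ⁻¹' {ρ | ∀ i ≤ n + 1, ρ i = x i} =
      {ρ | ∀ i ≤ n, ρ i = x (i + 1)} := by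
    intro x n hx
    ext ρ
    simp only [Set.mem_preimage, Set.mem_ofPred_eq]
    constructor
    · exact fun h i hi => h (i + 1) (by omega)
    · intro h i hi
      cases i with
      | zero => exact hx.symm
      | succ i => exact h i (by omega)
  have hsucc : ∀ (x : ℕ → S) n, x 0 = s → μ {ρ | ∀ i ≤ n + 1, ρ i = x i} = step [] s (x 1) *
      processLaw (fun w => step (s :: w)) (x 1) {ρ | ∀ i ≤ n, ρ i = x (i + 1)} := by
    intro x n hx
    rw [happ _ (measurableSet_prefixSet _ _), hcons x n hx]
    refine tsum_eq_single _ fun t ht => ?_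
    have hsub : {ρ : ℕ → S | ∀ i ≤ n, ρ i = x (i + 1)} ⊆ {ρ | ∀ i ≤ 0, ρ i = x (i + 1)} :=
      fun ρ h i hi => h i (by omega)
    rw [measure_mono_null hsub, mul_zero]
    rw [processLaw_prefixSet_zero _ _ fun i => x (i + 1), if_neg (Ne.symm ht)]
  have hz : ∀ x : ℕ → S, μ {ρ | ∀ i ≤ 0, ρ i = x i} = if x 0 = s then 1 else 0 := by
    intro x
    have : consRun s ⁻¹' {ρ | ∀ i ≤ 0, ρ i = x i} = if x 0 = s then Set.univ else ∅ := by
      ext ρ; split_ifs with h <;> simp [h, eq_comm (a := s)]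
    rw [happ _ (measurableSet_prefixSet _ _), this]
    split_ifs <;> simp [PMF.tsum_coe]
  have : μ = processLaw step s := by
    refine eq_processLaw hz fun x n hx => ?_
    rw [hsucc x n hx]
    cases n with
    | zero =>
      rw [processLaw_prefixSet_zero _ _ fun i => x (i + 1), hz, if_pos rfl, if_pos hx]
      simp [hx]
    | succ n =>
      rw [hsucc x n hx, processLaw_prefixSet_succ _ _ fun i => x (i + 1), mul_assoc]
      congr 2
      simp [List.ofFn_succ, hx]
  rw [← this, happ _ hA]

end Runs

/-! ### Reachability and safety values as fixed points of Bellman operators. -/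

section Bellman

variable {S : Type*}

/-- The expectation of `x` under the distribution `p`. -/
noncomputable def expect (p : PMF S) (x : S → ℝ≥0∞) : ℝ≥0∞ := ∑' t, p t * x t

lemma expect_mono_of_support {p : PMF S} {x y : S → ℝ≥0∞} (h : ∀ t, p t ≠ 0 → x t ≤ y t) :
    expect p x ≤ expect p y := by
  refine ENNReal.tsum_le_tsum fun t => ?_
  rcases eq_or_ne (p t) 0 with h0 | h0
  · simp [h0]
  · exact mul_le_mul_right (h t h0) _

lemma expect_mono {p : PMF S} {x y : S → ℝ≥0∞} (h : ∀ t, x t ≤ y t) : expect p x ≤ expect p y :=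
  expect_mono_of_support fun t _ => h t

lemma expect_const (p : PMF S) (c : ℝ≥0∞) : expect p (fun _ => c) = c := by
  rw [expect, ENNReal.tsum_mul_right, p.tsum_coe, one_mul]

lemma expect_add (p : PMF S) (x y : S → ℝ≥0∞) :
    expect p (fun t => x t + y t) = expect p x + expect p y := by
  simp only [expect, mul_add, ENNReal.tsum_add]

lemma expect_const_mul (p : PMF S) (c : ℝ≥0∞) (x : S → ℝ≥0∞) :
    expect p (fun t => c * x t) = c * expect p x := by
  simp only [expect, mul_left_comm _ c, ENNReal.tsum_mul_left]

lemma expect_pure (t : S) (x : S → ℝ≥0∞) : expect (PMF.pure t) x = x t := by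
  rw [expect, tsum_eq_single t]
  · simp
  · intro u hu; simp [PMF.pure_apply, hu]

lemma expect_le {p : PMF S} {x : S → ℝ≥0∞} {c : ℝ≥0∞} (h : ∀ t, p t ≠ 0 → x t ≤ c) :
    expect p x ≤ c :=
  (expect_mono_of_support h).trans (expect_const p c).le

lemma expect_iSup (p : PMF S) {x : ℕ → S → ℝ≥0∞} (hx : Monotone x) :
    expect p (fun t => ⨆ n, x n t) = ⨆ n, expect p (x n) := by
  let _ : MeasurableSpace S := ⊤
  have h : ∀ y : S → ℝ≥0∞, expect p y = ∫⁻ t, p t * y t ∂Measure.count := fun y =>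
    (lintegral_count _).symm
  simp only [h, ENNReal.mul_iSup]
  refine lintegral_iSup (fun n => measurable_from_top) fun n m hnm t => ?_
  exact mul_le_mul_right (hx hnm t) _

lemma expect_sub_sub {p : PMF S} {x y : S → ℝ≥0∞} :
    expect p x ≤ expect p (fun t => x t - y t) + expect p y := by
  rw [← expect_add]
  exact expect_mono fun t => le_tsub_add

/-- The supremum of the expectations of `x` under the distributions available in `s`. -/
noncomputable def bestExpect (P : S → Set (PMF S)) (x : S → ℝ≥0∞) (s : S) : ℝ≥0∞ :=
  ⨆ p ∈ P s, expect p x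

lemma expect_le_bestExpect {P : S → Set (PMF S)} {s : S} {p : PMF S} (hp : p ∈ P s)
    (x : S → ℝ≥0∞) : expect p x ≤ bestExpect P x s :=
  le_iSup₂ (f := fun q (_ : q ∈ P s) => expect q x) p hp

lemma bestExpect_mono {P : S → Set (PMF S)} {x y : S → ℝ≥0∞} (h : x ≤ y) (s : S) :
    bestExpect P x s ≤ bestExpect P y s :=
  iSup₂_mono fun _ _ => expect_mono h

lemma bestExpect_const_mul (P : S → Set (PMF S)) (c : ℝ≥0∞) (x : S → ℝ≥0∞) (s : S) :
    bestExpect P (fun t => c * x t) s = c * bestExpect P x s := by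
  simp only [bestExpect, expect_const_mul, ENNReal.mul_iSup]

lemma bestExpect_le_one {P : S → Set (PMF S)} {x : S → ℝ≥0∞} (hx : ∀ t, x t ≤ 1) (s : S) :
    bestExpect P x s ≤ 1 :=
  iSup₂_le fun _ _ => expect_le fun t _ => hx t

open Classical in
/-- The Bellman operator of the `γ`-discounted reachability of `G`. -/
noncomputable def reachOp (γ : ℝ≥0∞) (P : S → Set (PMF S)) (G : Set S) :
    (S → ℝ≥0∞) →o (S → ℝ≥0∞) where
  toFun x s := if s ∈ G then 1 else γ * bestExpect P x s
  monotone' x y h s := by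
    dsimp only
    split_ifs
    exacts [le_rfl, mul_le_mul_right (bestExpect_mono h s) _]

/-- The optimal `γ`-discounted probability of reaching `G`. -/
noncomputable def reachValue (γ : ℝ≥0∞) (P : S → Set (PMF S)) (G : Set S) : S → ℝ≥0∞ :=
  (reachOp γ P G).lfp

section Reach

variable {γ : ℝ≥0∞} {P : S → Set (PMF S)} {G : Set S}

lemma reachValue_of_mem {s : S} (hs : s ∈ G) : reachValue γ P G s = 1 := by
  rw [reachValue, ← OrderHom.map_lfp]
  exact if_pos hs

lemma reachValue_of_notMem {s : S} (hs : s ∉ G) :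
    reachValue γ P G s = γ * bestExpect P (reachValue γ P G) s := by
  conv_lhs => rw [reachValue, ← OrderHom.map_lfp]
  exact if_neg hs

lemma expect_le_reachValue {s : S} (hs : s ∉ G) {p : PMF S} (hp : p ∈ P s) :
    γ * expect p (reachValue γ P G) ≤ reachValue γ P G s := by
  rw [reachValue_of_notMem hs]
  exact mul_le_mul_right (expect_le_bestExpect hp _) _

lemma reachValue_le {x : S → ℝ≥0∞} (h1 : ∀ s ∈ G, 1 ≤ x s)
    (h2 : ∀ s ∉ G, ∀ p ∈ P s, γ * expect p x ≤ x s) (s : S) : reachValue γ P G s ≤ x s := by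
  classical
  refine OrderHom.lfp_le (reachOp γ P G) (a := x) (fun s => ?_) s
  change (if s ∈ G then _ else _) ≤ _
  split_ifs with hs
  · exact h1 s hs
  · rw [bestExpect]
    simp only [ENNReal.mul_iSup]
    exact iSup₂_le (h2 s hs)

lemma reachValue_le_one (hγ : γ ≤ 1) (s : S) : reachValue γ P G s ≤ 1 :=
  reachValue_le (x := fun _ => 1) (fun _ _ => le_rfl)
    (fun _ _ p _ => by rw [expect_const, mul_one]; exact hγ) s

lemma reachValue_mono {γ' : ℝ≥0∞} (h : γ ≤ γ') (s : S) :
    reachValue γ P G s ≤ reachValue γ' P G s :=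
  reachValue_le (fun _ hs => (reachValue_of_mem hs).ge)
    (fun _ hs _ hp => (mul_le_mul_left h _).trans (expect_le_reachValue hs hp)) s

/-- The discounted reachability values converge to the reachability value. -/
lemma exists_lt_reachValue {s : S} {c : ℝ≥0∞} (hc : c < reachValue 1 P G s) :
    ∃ γ < 1, c < reachValue γ P G s := by
  obtain ⟨u, hu, hu1, hlim⟩ := exists_seq_strictMono_tendsto' (zero_lt_one' ℝ≥0∞)
  -- The supremum of the discounted values is a supersolution of the undiscounted equation, so the
  -- least fixed point lies below it. The discount index and the value index are merged by taking
  -- their maximum.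
  have hle : ∀ t, reachValue 1 P G t ≤ ⨆ n, reachValue (u n) P G t := by
    intro t
    refine reachValue_le (x := fun t => ⨆ n, reachValue (u n) P G t)
      (fun t ht => le_iSup_of_le 0 (reachValue_of_mem ht).ge) (fun t ht p hp => ?_) t
    have hmono : Monotone fun n => reachValue (u n) P G :=
      fun n m h s => reachValue_mono (hu.monotone h) s
    rw [one_mul, expect_iSup p hmono]
    refine iSup_le fun n => ?_
    have hl : Tendsto (fun m => u m * expect p (reachValue (u n) P G)) atTop
        (nhds (1 * expect p (reachValue (u n) P G))) :=
      ENNReal.Tendsto.mul_const hlim (Or.inl one_ne_zero)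
    rw [one_mul] at hl
    refine le_of_tendsto' hl fun m => ?_
    refine le_trans ?_ (le_iSup (fun j => reachValue (u j) P G t) (max m n))
    refine le_trans ?_ (expect_le_reachValue ht hp)
    exact mul_le_mul' (hu.monotone (le_max_left _ _)) (expect_mono (hmono (le_max_right m n)))
  obtain ⟨n, hn⟩ := lt_iSup_iff.1 (hc.trans_le (hle s))
  exact ⟨u n, (hu1 n).2, hn⟩

end Reach

open Classical in
/-- The Bellman operator of the avoidance of `B`. -/
noncomputable def safeOp (P : S → Set (PMF S)) (B : Set S) :
    (S → ℝ≥0∞) →o (S → ℝ≥0∞) where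
  toFun x s := if s ∈ B then 0 else min 1 (bestExpect P x s)
  monotone' x y h s := by
    dsimp only
    split_ifs
    exacts [le_rfl, min_le_min le_rfl (bestExpect_mono h s)]

/-- The optimal probability of avoiding `B` forever. -/
noncomputable def safeValue (P : S → Set (PMF S)) (B : Set S) : S → ℝ≥0∞ :=
  (safeOp P B).gfp

section Safe

variable {P : S → Set (PMF S)} {B : Set S}

lemma safeValue_of_mem {s : S} (hs : s ∈ B) : safeValue P B s = 0 := by
  rw [safeValue, ← OrderHom.map_gfp]
  exact if_pos hs

lemma safeValue_of_notMem {s : S} (hs : s ∉ B) :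
    safeValue P B s = min 1 (bestExpect P (safeValue P B) s) := by
  conv_lhs => rw [safeValue, ← OrderHom.map_gfp]
  exact if_neg hs

lemma safeValue_le_one (s : S) : safeValue P B s ≤ 1 := by
  by_cases hs : s ∈ B
  · simp [safeValue_of_mem hs]
  · rw [safeValue_of_notMem hs]; exact min_le_left _ _

lemma safeValue_le_bestExpect (s : S) : safeValue P B s ≤ bestExpect P (safeValue P B) s := by
  by_cases hs : s ∈ B
  · simp [safeValue_of_mem hs]
  · conv_lhs => rw [safeValue_of_notMem hs]
    exact min_le_right _ _

lemma le_safeValue {x : S → ℝ≥0∞} (h0 : ∀ s ∈ B, x s = 0) (h1 : ∀ s, x s ≤ 1)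
    (h2 : ∀ s, x s ≤ bestExpect P x s) (s : S) : x s ≤ safeValue P B s := by
  classical
  refine OrderHom.le_gfp (safeOp P B) (a := x) (fun s => ?_) s
  change _ ≤ if s ∈ B then _ else _
  split_ifs with hs
  · exact (h0 s hs).le
  · exact le_min (h1 s) (h2 s)

/-- A subharmonic function that vanishes on `B` and where the safety value is large is zero. -/
lemma eq_zero_of_le_bestExpect {z : S → ℝ≥0∞} (h0 : ∀ s ∈ B, z s = 0) (h1 : ∀ s, z s ≤ 1)
    (h2 : ∀ s, z s ≤ bestExpect P z s) (h3 : ∀ s, 2⁻¹ ≤ safeValue P B s → z s = 0) (s : S) :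
    z s = 0 := by
  set m := ⨆ s, z s with hm
  have hz : ∀ s, z s ≤ m := le_iSup z
  have hm1 : m ≤ 1 := iSup_le h1
  have hmt : m ≠ ⊤ := ne_top_of_le_ne_top ENNReal.one_ne_top hm1
  by_contra hs
  have hm0 : m ≠ 0 := fun h => hs (le_zero_iff.1 ((hz s).trans h.le))
  -- Rescaled to have supremum 1, `z` is still a candidate in the coinduction for `safeValue`. Hence
  -- `z ≤ m / 2` where the safety value is below 1/2, and `z = 0` elsewhere; this forces the
  -- supremum `m` to vanish.
  have key : ∀ s, m⁻¹ * z s ≤ safeValue P B s := by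
    refine le_safeValue (fun s hs => by rw [h0 s hs, mul_zero]) (fun s => ?_) fun s => ?_
    · calc m⁻¹ * z s ≤ m⁻¹ * m := mul_le_mul_right (hz s) _
        _ = 1 := ENNReal.inv_mul_cancel hm0 hmt
    · rw [bestExpect_const_mul]
      exact mul_le_mul_right (h2 s) _
  have hhalf : m ≤ m * 2⁻¹ := by
    refine iSup_le fun s => ?_
    by_cases hv : 2⁻¹ ≤ safeValue P B s
    · simp [h3 s hv]
    · calc z s = m * (m⁻¹ * z s) := by rw [← mul_assoc, ENNReal.mul_inv_cancel hm0 hmt, one_mul]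
        _ ≤ m * 2⁻¹ := mul_le_mul_right ((key s).trans (not_le.1 hv).le) _
  exact absurd (hhalf.trans_eq (div_eq_mul_inv m 2).symm) (not_le.2 (ENNReal.half_lt_self hm0 hmt))

end Safe

/-- On an acyclic countable graph there is a small potential that decreases strictly along every
edge. -/
lemma exists_potential [Countable S] {r : S → S → Prop} (hr : ∀ s, ¬ Relation.TransGen r s s)
    {c : ℝ≥0∞} (hc : c ≠ 0) :
    ∃ ε ψ : S → ℝ≥0∞, (∀ s, ε s ≠ 0) ∧ (∀ s, ψ s ≤ c) ∧ ∀ s t, r s t → ψ t + ε s ≤ ψ s := by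
  classical
  obtain ⟨ε, hε, hsum⟩ := ENNReal.exists_pos_sum_of_countable hc S
  -- The potential of `s` is the total weight of the states reachable from `s`, itself included.
  -- Along an edge the source is lost, since in an acyclic graph it is not reachable from its
  -- successor.
  refine ⟨fun s => ε s, fun s => ∑' t, if Relation.ReflTransGen r s t then (ε t : ℝ≥0∞) else 0,
    fun s => by simpa using (hε s).ne', fun s => ?_, fun s t hst => ?_⟩
  · refine (ENNReal.tsum_le_tsum fun t => ?_).trans hsum.le
    split_ifs <;> simp
  · have : (ε s : ℝ≥0∞) = ∑' u, if u = s then (ε u : ℝ≥0∞) else 0 := by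
      rw [tsum_ite_eq]
    dsimp only
    rw [this, ← ENNReal.tsum_add]
    refine ENNReal.tsum_le_tsum fun u => ?_
    by_cases hu : u = s
    · subst hu
      rw [if_neg fun h => hr u (Relation.TransGen.head' hst h), if_pos rfl,
        if_pos Relation.ReflTransGen.refl, zero_add]
    · rw [if_neg hu, add_zero]
      by_cases h : Relation.ReflTransGen r t u
      · rw [if_pos h, if_pos (h.head hst)]
      · rw [if_neg h]; exact zero_le

lemma exists_near_bestExpect {P : S → Set (PMF S)} (hP : ∀ s, (P s).Nonempty) {x : S → ℝ≥0∞}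
    (hx : ∀ s, x s ≤ 1) {ε : S → ℝ≥0∞} (hε : ∀ s, ε s ≠ 0) :
    ∃ f : S → PMF S, (∀ s, f s ∈ P s) ∧ ∀ s, bestExpect P x s ≤ expect (f s) x + ε s := by
  have : ∀ s, ∃ p ∈ P s, bestExpect P x s ≤ expect p x + ε s := by
    intro s
    rcases eq_or_ne (bestExpect P x s) 0 with h | h
    · obtain ⟨p, hp⟩ := hP s
      exact ⟨p, hp, by simp [h]⟩
    · have hlt : bestExpect P x s - ε s < bestExpect P x s :=
        ENNReal.sub_lt_self (ne_top_of_le_ne_top ENNReal.one_ne_top (bestExpect_le_one hx s)) h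
          (hε s)
      simp only [bestExpect, lt_iSup_iff] at hlt
      obtain ⟨p, hp, hlt⟩ := hlt
      exact ⟨p, hp, tsub_le_iff_right.1 hlt.le⟩
  choose f hf using this
  exact ⟨f, fun s => (hf s).1, fun s => (hf s).2⟩

/-- The drop `ε` of the potential `ψ` along an edge pays for the error of a near-optimal choice, so
the value minus the potential is exactly subharmonic up to the discount. The free constant `a`
allows a truncation at a chosen level. -/
lemma sub_le_expect_sub {p : PMF S} {γ ε a b c : ℝ≥0∞} {x ψ : S → ℝ≥0∞} (hγ : γ ≤ 1)
    (hx : c ≤ γ * (expect p x + ε)) (hψ : ∀ t, p t ≠ 0 → ψ t + ε ≤ b) :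
    c - (b + a) ≤ γ * expect p fun t => x t - (ψ t + a) := by
  refine tsub_le_iff_right.2 (hx.trans ?_)
  have h1 : expect p x + ε ≤ expect p (fun t => x t - (ψ t + a)) + (b + a) := by
    refine (add_le_add_left (expect_sub_sub (y := fun t => ψ t + a)) ε).trans ?_
    rw [add_assoc]
    refine add_le_add_right ?_ _
    calc expect p (fun t => ψ t + a) + ε = expect p (fun t => (ψ t + a) + ε) := by
          rw [expect_add p (fun t => ψ t + a), expect_const]
      _ ≤ b + a := expect_le fun t ht => by rw [add_right_comm]; exact add_le_add_left (hψ t ht) _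
  refine (mul_le_mul_right h1 γ).trans ?_
  rw [mul_add]
  exact add_le_add_right (mul_le_of_le_one_left zero_le hγ) _

/-- The distribution in the states of `R` is fixed to the one given by `f`. -/
def fixOn (P : S → Set (PMF S)) (R : Set S) (f : S → PMF S) (s : S) : Set (PMF S) :=
  {p | p ∈ P s ∧ (s ∈ R → p = f s)}

section Fix

variable {P : S → Set (PMF S)} {G R : Set S} {f : S → PMF S}

lemma fixOn_of_notMem {s : S} (hs : s ∉ R) : fixOn P R f s = P s := by
  ext p; simp [fixOn, hs]

lemma fixOn_of_mem (hf : ∀ s, f s ∈ P s) {s : S} (hs : s ∈ R) : fixOn P R f s = {f s} := by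
  ext p
  simp only [fixOn, Set.mem_ofPred_eq, hs, true_imp_iff, Set.mem_singleton_iff]
  exact ⟨fun h => h.2, fun h => ⟨h ▸ hf s, h⟩⟩

lemma mem_fixOn (hf : ∀ s, f s ∈ P s) (s : S) : f s ∈ fixOn P R f s :=
  ⟨hf s, fun _ => rfl⟩

/-- If `G` is reached almost surely, then this remains possible after fixing choices in a set of
states from which `G` is still reached with probability at least `a > 0`. -/
lemma reachValue_fixOn_eq_one (h1 : ∀ s, reachValue 1 P G s = 1)
    {a : ℝ≥0∞} (ha0 : a ≠ 0) (ha1 : a < 1)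
    (hR : ∀ s ∈ R, a ≤ reachValue 1 (fixOn P R f) G s) (s : S) :
    reachValue 1 (fixOn P R f) G s = 1 := by
  set v := reachValue 1 (fixOn P R f) G with hv
  have hat : a ≠ ⊤ := ne_top_of_lt ha1
  have hv1 : ∀ s, v s ≤ 1 := reachValue_le_one le_rfl
  have hav : ∀ s, a ≤ v s := by
    intro s
    -- The function `min 1 (v / a)` is superharmonic for all the original choices: it is 1 on `R`,
    -- and outside `R` nothing was fixed. It therefore dominates the original value 1.
    have : reachValue 1 P G s ≤ min 1 (a⁻¹ * v s) := by
      refine reachValue_le (x := fun s => min 1 (a⁻¹ * v s)) (fun s hs => ?_)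
        (fun s hs p hp => ?_) s
      · refine le_min le_rfl ?_
        rw [hv, reachValue_of_mem hs, mul_one]
        exact ENNReal.one_le_inv.2 ha1.le
      · rw [one_mul]
        refine le_min (expect_le fun _ _ => min_le_left _ _) ?_
        by_cases hsR : s ∈ R
        · refine (expect_le (c := 1) fun _ _ => min_le_left _ _).trans ?_
          rw [← ENNReal.inv_mul_cancel ha0 hat]
          exact mul_le_mul_right (hR s hsR) _
        · refine (expect_mono (y := fun t => a⁻¹ * v t) fun _ => min_le_right _ _).trans ?_
          rw [expect_const_mul]
          have := expect_le_reachValue (γ := 1) (P := fixOn P R f) hs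
            (by rw [fixOn_of_notMem hsR]; exact hp)
          rw [one_mul] at this
          exact mul_le_mul_right this _
    rw [h1 s] at this
    have := mul_le_mul_right (this.trans (min_le_right _ _)) a
    rwa [mul_one, ← mul_assoc, ENNReal.mul_inv_cancel ha0 hat, one_mul] at this
  have hb0 : 1 - a ≠ 0 := (tsub_pos_of_lt ha1).ne'
  have hbt : 1 - a ≠ ⊤ := ne_top_of_le_ne_top ENNReal.one_ne_top tsub_le_self
  -- Since `v ≥ a`, the affine rescaling of `v` that sends `a` to 0 and 1 to 1 is again a
  -- supersolution. Minimality of `v` then gives `a ≤ a * v`.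
  have hle : v s ≤ (1 - a)⁻¹ * (v s - a) := by
    refine reachValue_le (x := fun s => (1 - a)⁻¹ * (v s - a)) (fun s hs => ?_)
      (fun s hs p hp => ?_) s
    · rw [hv, reachValue_of_mem hs, ENNReal.inv_mul_cancel hb0 hbt]
    · rw [one_mul, expect_const_mul]
      refine mul_le_mul_right (ENNReal.le_sub_of_add_le_right hat ?_) _
      have h2 : expect p (fun t => v t - a) + a = expect p v := by
        conv_lhs => rw [← expect_const p a, ← expect_add]
        congr 1
        funext t
        rw [expect_const]
        exact tsub_add_cancel_of_le (hav t)
      rw [h2]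
      have := expect_le_reachValue (γ := 1) hs hp
      rwa [one_mul] at this
  have h3 : (1 - a) * v s + a ≤ v s := by
    have := mul_le_mul_right hle (1 - a)
    rw [← mul_assoc, ENNReal.mul_inv_cancel hb0 hbt, one_mul] at this
    calc (1 - a) * v s + a ≤ (v s - a) + a := add_le_add_left this _
      _ = v s := tsub_add_cancel_of_le (hav s)
  have h4 : (1 - a) * v s + a * v s = v s := by
    rw [← add_mul, tsub_add_cancel_of_le ha1.le, one_mul]
  have h5 : a * 1 ≤ a * v s := by
    rw [mul_one]
    refine (ENNReal.add_le_add_iff_left (a := (1 - a) * v s) ?_).1 (h3.trans h4.ge)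
    exact ENNReal.mul_ne_top hbt (ne_top_of_le_ne_top ENNReal.one_ne_top (hv1 s))
  exact le_antisymm (hv1 s) ((ENNReal.mul_le_mul_iff_right ha0 hat).1 h5)

end Fix

end Bellman

/-! ### Fixing choices while keeping the reachability value equal to 1. -/

section Refine

variable {S : Type*} [Countable S] {r : S → S → Prop} {P : S → Set (PMF S)} {G : Set S}

/-- In an acyclic decision process in which `G` is reached almost surely, choices can be fixed in
such a way that `G` is still reached almost surely, and from a given state with probability at least
`1 / 4` for all the remaining choices (as witnessed by the function `k`). -/
lemma exists_reach_refinement (hr : ∀ s, ¬ Relation.TransGen r s s) (hP : ∀ s, (P s).Nonempty)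
    (hPr : ∀ s, ∀ p ∈ P s, ∀ t, p t ≠ 0 → r s t) (h1 : ∀ s, reachValue 1 P G s = 1) (s₁ : S) :
    ∃ P' : S → Set (PMF S), (∀ s, (P' s).Nonempty) ∧ (∀ s, P' s ⊆ P s) ∧
      (∀ s, P' s = P s ∨ ∃ p, P' s = {p}) ∧ (∀ s, reachValue 1 P' G s = 1) ∧
      ∃ γ < 1, ∃ k : S → ℝ≥0∞, (∀ s, k s ≤ 1) ∧ 4⁻¹ ≤ k s₁ ∧
        ∀ s ∉ G, ∀ p ∈ P' s, k s ≤ γ * expect p k := by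
  -- The constants satisfy 7/8 = 1/8 + 1/2 + 1/4: the bound on the potential, the truncation level
  -- and the remaining lower bound for `k s₁`. A discount is needed because an undiscounted
  -- subharmonic function, such as a constant, need not bound a reachability probability from below.
  obtain ⟨γ, hγ, hγs⟩ := exists_lt_reachValue (P := P) (G := G) (s := s₁) (c := 7 / 8) (by
    rw [h1]
    exact ENNReal.div_lt_of_lt_mul (by norm_num))
  obtain ⟨ε, ψ, hε, hψ, hψr⟩ := exists_potential hr (c := 8⁻¹) (by simp)
  set w := reachValue γ P G with hw
  have hw1 : ∀ s, w s ≤ 1 := reachValue_le_one hγ.le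
  obtain ⟨f, hfP, hf⟩ := exists_near_bestExpect hP hw1 hε
  have hk : ∀ a, ∀ s ∉ G, w s - (ψ s + a) ≤ γ * expect (f s) fun t => w t - (ψ t + a) := by
    intro a s hs
    refine sub_le_expect_sub (ε := ε s) hγ.le ?_ fun t ht => hψr s t (hPr s _ (hfP s) t ht)
    rw [hw, reachValue_of_notMem hs]
    exact mul_le_mul_right (hf s) _
  set k : S → ℝ≥0∞ := fun s => w s - (ψ s + 2⁻¹) with hkdef
  set R : Set S := {s | s ∉ G ∧ k s ≠ 0} with hR
  set v := reachValue 1 (fixOn P R f) G with hv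
  -- Playing `f` everywhere is still allowed after the fixing, and it achieves `w - ψ`: after `n`
  -- steps the unaccounted part is at most `γ ^ n`. On `R` this exceeds 1/2, as
  -- `reachValue_fixOn_eq_one` requires.
  have hgv : ∀ s, w s - (ψ s + 0) ≤ v s := by
    have hz : ∀ n : ℕ, ∀ s, w s - (ψ s + 0) ≤ γ ^ n + v s := by
      intro n
      induction n with
      | zero => intro s; exact (tsub_le_self.trans (hw1 s)).trans (by simp)
      | succ n ih =>
        intro s
        by_cases hs : s ∈ G
        · rw [hv, reachValue_of_mem hs]
          exact (tsub_le_self.trans (hw1 s)).trans le_add_self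
        · refine (hk 0 s hs).trans ((mul_le_mul_right (expect_mono ih) _).trans ?_)
          rw [expect_add _ (fun _ => γ ^ n), expect_const, mul_add, pow_succ']
          refine add_le_add_right (le_trans ?_
            (expect_le_reachValue (γ := 1) hs (mem_fixOn (R := R) hfP s))) _
          exact mul_le_mul_left hγ.le _
    intro s
    have hl : Tendsto (fun n : ℕ => γ ^ n + v s) atTop (nhds (0 + v s)) :=
      (ENNReal.tendsto_pow_atTop_nhds_zero_of_lt_one hγ).add_const _
    rw [zero_add] at hl
    exact ge_of_tendsto' hl fun n => hz n s
  refine ⟨fixOn P R f, fun s => ⟨f s, mem_fixOn hfP s⟩, fun s p hp => hp.1, fun s => ?_,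
    reachValue_fixOn_eq_one h1 (a := 2⁻¹) (by simp) (by simp) fun s hs => ?_,
    γ, hγ, k, fun s => tsub_le_self.trans (hw1 s), ?_, fun s hs p hp => ?_⟩
  · by_cases hs : s ∈ R
    · exact Or.inr ⟨_, fixOn_of_mem hfP hs⟩
    · exact Or.inl (fixOn_of_notMem hs)
  · refine le_trans ?_ (hgv s)
    rw [add_zero]
    refine ENNReal.le_sub_of_add_le_right
      (ne_top_of_le_ne_top (by simp) (hψ s)) ?_
    have := (tsub_pos_iff_lt.1 (pos_iff_ne_zero.2 hs.2)).le
    rwa [add_comm] at this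
  · refine ENNReal.le_sub_of_add_le_right
      (ne_top_of_le_ne_top (by simp) (add_le_add_left (hψ s₁) _)) ?_
    refine le_trans ?_ hγs.le
    refine (add_le_add_right (add_le_add_left (hψ s₁) _) _).trans_eq ?_
    rw [← ENNReal.toReal_eq_toReal_iff' (by simp) (ENNReal.div_ne_top (by simp) (by simp)),
      ENNReal.toReal_add (by simp) (by simp), ENNReal.toReal_add (by simp) (by simp)]
    simp only [ENNReal.toReal_inv, ENNReal.toReal_div, ENNReal.toReal_ofNat]
    norm_num
  -- Truncation makes the bound independent of the choices left open: outside `R` and `G` the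
  -- function `k` vanishes, and on `R` only `f s` remains.
  · by_cases hkR : k s = 0
    · rw [hkR]; exact zero_le
    · rw [hp.2 ⟨hs, hkR⟩]
      exact hk 2⁻¹ s hs

/-- In an acyclic decision process in which `G` is reached almost surely, there is a choice in every
state that reaches `G` from every state with probability at least `1 / 4`. -/
lemma exists_uniform_reach (hr : ∀ s, ¬ Relation.TransGen r s s) (hP : ∀ s, (P s).Nonempty)
    (hPr : ∀ s, ∀ p ∈ P s, ∀ t, p t ≠ 0 → r s t) (h1 : ∀ s, reachValue 1 P G s = 1) :
    ∃ d : S → PMF S, (∀ s, d s ∈ P s) ∧ ∀ s₁, ∃ γ < 1, ∃ k : S → ℝ≥0∞, (∀ s, k s ≤ 1) ∧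
      4⁻¹ ≤ k s₁ ∧ ∀ s ∉ G, k s ≤ γ * expect (d s) k := by
  rcases isEmpty_or_nonempty S with hS | hS
  · exact ⟨fun s => (hS.false s).elim, fun s => (hS.false s).elim, fun s => (hS.false s).elim⟩
  obtain ⟨e, he⟩ := exists_surjective_nat S
  let T := {Q : S → Set (PMF S) // (∀ s, (Q s).Nonempty) ∧ (∀ s, Q s ⊆ P s) ∧
    ∀ s, reachValue 1 Q G s = 1}
  have hnext : ∀ (Q : T) (s₁ : S), ∃ Q' : T, (∀ s, Q'.1 s ⊆ Q.1 s) ∧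
      (∀ s, Q'.1 s = Q.1 s ∨ ∃ p, Q'.1 s = {p}) ∧ ∃ γ < 1, ∃ k : S → ℝ≥0∞, (∀ s, k s ≤ 1) ∧
        4⁻¹ ≤ k s₁ ∧ ∀ s ∉ G, ∀ p ∈ Q'.1 s, k s ≤ γ * expect p k := by
    rintro ⟨Q, hQ, hQP, hQ1⟩ s₁
    obtain ⟨Q', h1, h2, h3, h4, h5⟩ := exists_reach_refinement hr hQ
      (fun s p hp => hPr s p (hQP s hp)) hQ1 s₁
    exact ⟨⟨Q', h1, fun s => (h2 s).trans (hQP s), h4⟩, h2, h3, h5⟩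
  choose next hnsub hnfix hnk using hnext
  let Q : ℕ → T := fun n =>
    Nat.rec (⟨P, hP, fun _ => subset_rfl, h1⟩ : T) (fun n Q => next Q (e n)) n
  have hQ : ∀ n, Q (n + 1) = next (Q n) (e n) := fun n => rfl
  have hanti : ∀ s, Antitone fun n => (Q n).1 s := fun s =>
    antitone_nat_of_succ_le fun n => by rw [hQ]; exact hnsub _ _ s
  -- The choice sets decrease, and at each state either never change or become a singleton at some
  -- stage, so their intersection is nonempty. It need not be known to preserve the value 1: each
  -- stage's bound `k` already holds for every choice left afterwards.
  have hd : ∀ s, ∃ p, ∀ n, p ∈ (Q n).1 s := by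
    intro s
    by_cases h : ∃ n p, (Q n).1 s = {p}
    · obtain ⟨n, p, hn⟩ := h
      refine ⟨p, fun m => ?_⟩
      obtain ⟨q, hq⟩ := (Q (max n m)).2.1 s
      have hqp : q ∈ (Q n).1 s := hanti s (le_max_left n m) hq
      rw [hn, Set.mem_singleton_iff] at hqp
      exact hanti s (le_max_right n m) (hqp ▸ hq)
    · push Not at h
      obtain ⟨p, hp⟩ := hP s
      refine ⟨p, fun n => ?_⟩
      induction n with
      | zero => exact hp
      | succ n ih =>
        rcases hnfix (Q n) (e n) s with h' | ⟨q, hq⟩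
        · rw [hQ, h']; exact ih
        · exact absurd hq (h (n + 1) q)
  choose d hd using hd
  refine ⟨d, fun s => hd s 0, fun s₁ => ?_⟩
  obtain ⟨n, rfl⟩ := he s₁
  obtain ⟨γ, hγ, k, hk1, hk2, hk3⟩ := hnk (Q n) (e n)
  exact ⟨γ, hγ, k, hk1, hk2, fun s hs => hk3 s hs _ (hd s (n + 1))⟩

/-- In an acyclic decision process in which almost surely a set `G` is reached that contains all
states with a large safety value, choices can be fixed in such a way that `G` is still reached
almost surely, and states with a large safety value are safe with probability at least `1 / 12` for
all the remaining choices (as witnessed by the function `k`). -/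
lemma exists_safe_refinement {B : Set S} (hr : ∀ s, ¬ Relation.TransGen r s s)
    (hP : ∀ s, (P s).Nonempty) (hPr : ∀ s, ∀ p ∈ P s, ∀ t, p t ≠ 0 → r s t)
    (hG : ∀ s, 2⁻¹ ≤ safeValue P B s → s ∈ G) (h1 : ∀ s, reachValue 1 P G s = 1) :
    ∃ P' : S → Set (PMF S), (∀ s, (P' s).Nonempty) ∧ (∀ s, P' s ⊆ P s) ∧
      (∀ s, reachValue 1 P' G s = 1) ∧
      ∃ k : S → ℝ≥0∞, (∀ s, k s ≤ 1) ∧ (∀ s ∈ B, k s = 0) ∧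
        (∀ s, 2⁻¹ ≤ safeValue P B s → 12⁻¹ ≤ k s) ∧ ∀ s, ∀ p ∈ P' s, k s ≤ expect p k := by
  -- Here 1/2 = 1/12 + 1/3 + 1/12: potential, truncation level, and the safety that remains. No
  -- discount is needed, because safety is a greatest fixed point.
  obtain ⟨ε, ψ, hε, hψ, hψr⟩ := exists_potential hr (c := 12⁻¹) (by simp)
  set w := safeValue P B with hw
  have hw1 : ∀ s, w s ≤ 1 := safeValue_le_one
  obtain ⟨f, hfP, hf⟩ := exists_near_bestExpect hP hw1 hε
  have hk : ∀ a s, w s - (ψ s + a) ≤ expect (f s) fun t => w t - (ψ t + a) := by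
    intro a s
    rw [← one_mul (expect _ _)]
    refine sub_le_expect_sub (ε := ε s) le_rfl ?_ fun t ht => hψr s t (hPr s _ (hfP s) t ht)
    rw [one_mul]
    exact (safeValue_le_bestExpect s).trans (hf s)
  set k : S → ℝ≥0∞ := fun s => w s - (ψ s + 3⁻¹) with hkdef
  set R : Set S := {s | k s ≠ 0} with hR
  set v := reachValue 1 (fixOn P R f) G with hv
  -- Near-optimal safe play must lead to states of large safety value, which lie in `G`. Formally,
  -- `w - ψ - v` is subharmonic and vanishes on `B` and on `G`, so `eq_zero_of_le_bestExpect` kills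
  -- it.
  have hgv : ∀ s, w s - (ψ s + 0) ≤ v s := by
    intro s
    refine tsub_eq_zero_iff_le.1 ?_
    refine eq_zero_of_le_bestExpect (P := P) (B := B) (z := fun s => w s - (ψ s + 0) - v s)
      (fun s hs => ?_) (fun s => tsub_le_self.trans (tsub_le_self.trans (hw1 s))) (fun s => ?_)
      (fun s hs => ?_) s
    · simp [hw, safeValue_of_mem hs]
    · by_cases hs : s ∈ G
      · rw [hv, reachValue_of_mem hs,
          tsub_eq_zero_of_le (tsub_le_self.trans (hw1 s))]
        exact zero_le
      · refine le_trans ?_ (expect_le_bestExpect (hfP s) _)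
        refine tsub_le_iff_right.2 ((hk 0 s).trans (expect_sub_sub.trans (add_le_add_right ?_ _)))
        have := expect_le_reachValue (γ := 1) hs (mem_fixOn (R := R) hfP s)
        rwa [one_mul] at this
    · rw [hv, reachValue_of_mem (hG s hs), tsub_eq_zero_of_le (tsub_le_self.trans (hw1 s))]
  refine ⟨fixOn P R f, fun s => ⟨f s, mem_fixOn hfP s⟩, fun s p hp => hp.1,
    reachValue_fixOn_eq_one h1 (a := 3⁻¹) (by simp) (by simp) fun s hs => ?_,
    k, fun s => tsub_le_self.trans (hw1 s), fun s hs => by simp [hkdef, hw, safeValue_of_mem hs],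
    fun s hs => ?_, fun s p hp => ?_⟩
  · refine le_trans ?_ (hgv s)
    rw [add_zero]
    refine ENNReal.le_sub_of_add_le_right
      (ne_top_of_le_ne_top (by simp) (hψ s)) ?_
    have := (tsub_pos_iff_lt.1 (pos_iff_ne_zero.2 hs)).le
    rwa [add_comm] at this
  · refine ENNReal.le_sub_of_add_le_right
      (ne_top_of_le_ne_top (by simp) (add_le_add_left (hψ s) _)) ?_
    refine le_trans ?_ hs
    refine (add_le_add_right (add_le_add_left (hψ s) _) _).trans_eq ?_
    rw [← ENNReal.toReal_eq_toReal_iff' (by simp) (by simp),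
      ENNReal.toReal_add (by simp) (by simp), ENNReal.toReal_add (by simp) (by simp)]
    simp only [ENNReal.toReal_inv, ENNReal.toReal_ofNat]
    norm_num
  · by_cases hkR : k s = 0
    · rw [hkR]; exact zero_le
    · rw [hp.2 hkR]
      exact hk 3⁻¹ s

end Refine

/-- The induction step for events of finite horizon: once the first state is known, the horizon
shrinks by one. -/
lemma preimage_consRun_dependsOn {S : Type*} {C : Set (ℕ → S)} {n : ℕ}
    (hC : ∀ ρ ρ' : ℕ → S, (∀ i < n + 1, ρ i = ρ' i) → ρ ∈ C → ρ' ∈ C) (s : S) (ρ ρ' : ℕ → S)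
    (h : ∀ i < n, ρ i = ρ' i) (hρ : ρ ∈ consRun s ⁻¹' C) : ρ' ∈ consRun s ⁻¹' C := by
  refine hC _ _ (fun i hi => ?_) hρ
  cases i with
  | zero => rfl
  | succ i => exact h i (by omega)

lemma measure_le_add_of_symmDiff {α : Type*} [MeasurableSpace α] {μ : Measure α} {A C : Set α}
    {δ : ℝ≥0∞} (h : μ (symmDiff C A) ≤ δ) : μ A ≤ μ C + δ ∧ μ C ≤ μ A + δ := by
  constructor
  · refine (measure_mono (t := C ∪ symmDiff C A) fun x hx => ?_).trans
      ((measure_union_le _ _).trans (add_le_add_right h _))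
    by_cases hxC : x ∈ C
    · exact Or.inl hxC
    · exact Or.inr (Or.inr ⟨hx, hxC⟩)
  · refine (measure_mono (t := A ∪ symmDiff C A) fun x hx => ?_).trans
      ((measure_union_le _ _).trans (add_le_add_right h _))
    by_cases hxA : x ∈ A
    · exact Or.inl hxA
    · exact Or.inr (Or.inl ⟨hx, hxA⟩)

lemma measurableSet_coord {S : Type*} [MeasurableSpace S] [DiscreteMeasurableSpace S]
    (n : ℕ) (A : Set S) : MeasurableSet {ρ : ℕ → S | ρ n ∈ A} :=
  (MeasurableSet.of_discrete (s := A)).preimage (measurable_pi_apply n)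

lemma measurableSet_exists_mem {S : Type*} [MeasurableSpace S] [DiscreteMeasurableSpace S]
    (A : Set S) (p : ℕ → Prop) :
    MeasurableSet {ρ : ℕ → S | ∃ n, p n ∧ ρ n ∈ A} := by
  have : {ρ : ℕ → S | ∃ n, p n ∧ ρ n ∈ A} = ⋃ n, ⋃ _ : p n, {ρ | ρ n ∈ A} := by
    ext; simp
  rw [this]
  exact MeasurableSet.iUnion fun n => MeasurableSet.iUnion fun _ => measurableSet_coord n A

lemma measurableSet_forall_mem {S : Type*} [MeasurableSpace S] [DiscreteMeasurableSpace S]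
    (A : Set S) (p : ℕ → Prop) :
    MeasurableSet {ρ : ℕ → S | ∀ n, p n → ρ n ∈ A} := by
  have : {ρ : ℕ → S | ∀ n, p n → ρ n ∈ A} = ⋂ n, ⋂ _ : p n, {ρ | ρ n ∈ A} := by
    ext; simp
  rw [this]
  exact MeasurableSet.iInter fun n => MeasurableSet.iInter fun _ => measurableSet_coord n A

/-! ### Markov chains: zero-one laws, bounds by subharmonic functions and change of measure. -/

section Chain

variable {S : Type*} [Countable S] [MeasurableSpace S] [DiscreteMeasurableSpace S]

/-- The law of the Markov chain with transition probabilities `d` that starts in `s`. -/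
noncomputable def chainLaw (d : S → PMF S) (s : S) : Measure (ℕ → S) :=
  processLaw (fun _ => d) s

instance (d : S → PMF S) (s : S) : IsProbabilityMeasure (chainLaw d s) := by
  unfold chainLaw; infer_instance

lemma chainLaw_apply (d : S → PMF S) (s : S) {A : Set (ℕ → S)} (hA : MeasurableSet A) :
    chainLaw d s A = expect (d s) fun t => chainLaw d t (consRun s ⁻¹' A) :=
  processLaw_apply _ _ hA

lemma chainLaw_prob_eq_one_of_mem (d : S → PMF S) {s : S} {A : Set (ℕ → S)} (hA : MeasurableSet A)
    (h : ∀ ρ, consRun s ρ ∈ A) : chainLaw d s A = 1 := by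
  have : consRun s ⁻¹' A = Set.univ := Set.eq_univ_of_forall h
  rw [chainLaw_apply d s hA, this]
  simp only [measure_univ, expect_const]

/-- A zero-one law: an event that is inherited by suffixes and whose probability is bounded away
from one has probability zero. -/
lemma chainLaw_eq_zero_of_le {d : S → PMF S} {N : Set (ℕ → S)} (hN : MeasurableSet N)
    (hsuf : ∀ s ρ, consRun s ρ ∈ N → ρ ∈ N) {c : ℝ≥0∞} (hc : c < 1)
    (hle : ∀ s, chainLaw d s N ≤ c) (s : S) : chainLaw d s N = 0 := by
  -- Given any finite past, `N` still has conditional probability at most `c`. Approximating `N`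
  -- itself by such events `C` yields `P(N) ≤ c * P(N)`.
  have key : ∀ n, ∀ C : Set (ℕ → S), MeasurableSet C →
      (∀ ρ ρ' : ℕ → S, (∀ i < n, ρ i = ρ' i) → ρ ∈ C → ρ' ∈ C) →
      ∀ s, chainLaw d s (N ∩ C) ≤ c * chainLaw d s C := by
    intro n
    induction n with
    | zero =>
      intro C _ hC s
      rcases C.eq_empty_or_nonempty with rfl | ⟨ρ, hρ⟩
      · simp
      · have : C = Set.univ := Set.eq_univ_of_forall fun ρ' => hC ρ ρ' (by simp) hρ
        simpa [this] using hle s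
    | succ n ih =>
      intro C hCm hC s
      rw [chainLaw_apply d s (hN.inter hCm), chainLaw_apply d s hCm, ← expect_const_mul]
      refine expect_mono fun t => ?_
      refine (measure_mono (t := N ∩ consRun s ⁻¹' C) fun ρ hρ => ⟨hsuf s ρ hρ.1, hρ.2⟩).trans ?_
      exact ih _ (hCm.preimage (measurable_consRun s)) (preimage_consRun_dependsOn hC s) t
  have hle' : chainLaw d s N ≤ c * chainLaw d s N := by
    refine ENNReal.le_of_forall_pos_le_add fun δ hδ _ => ?_
    obtain ⟨C, hCm, ⟨n, hC⟩, hlt⟩ := exists_dependsOn_symmDiff_lt (chainLaw d s) hN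
      (ε := (δ : ℝ≥0∞) / 2) (by simpa using hδ.ne')
    have h1 := measure_le_add_of_symmDiff hlt.le
    have h2 : chainLaw d s N ≤ chainLaw d s (N ∩ C) + δ / 2 := by
      refine (measure_mono (t := (N ∩ C) ∪ symmDiff C N) fun x hx => ?_).trans
        ((measure_union_le _ _).trans (add_le_add_right hlt.le _))
      by_cases hxC : x ∈ C
      · exact Or.inl ⟨hx, hxC⟩
      · exact Or.inr (Or.inr ⟨hx, hxC⟩)
    calc chainLaw d s N ≤ c * chainLaw d s C + δ / 2 :=
          h2.trans (add_le_add_left (key n C hCm hC s) _)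
      _ ≤ c * (chainLaw d s N + δ / 2) + δ / 2 :=
          add_le_add_left (mul_le_mul_right h1.2 _) _
      _ ≤ c * chainLaw d s N + δ := by
          rw [mul_add, add_assoc]
          refine add_le_add_right ?_ _
          conv_rhs => rw [← ENNReal.add_halves (δ : ℝ≥0∞)]
          exact add_le_add_left (mul_le_of_le_one_left zero_le hc.le) _
  by_contra h0
  have h1 := (ENNReal.mul_lt_mul_iff_left h0 (measure_ne_top (chainLaw d s) N)).2 hc
  rw [one_mul] at h1
  exact absurd hle' (not_le.2 h1)

/-- If `k` is subharmonic off `G` up to a discount, then it is a lower bound of the probability to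
reach `G`. -/
lemma le_chainLaw_exists_mem {d : S → PMF S} {G : Set S} {γ : ℝ≥0∞} (hγ : γ < 1) {k : S → ℝ≥0∞}
    (hk1 : ∀ s, k s ≤ 1) (hk : ∀ s ∉ G, k s ≤ γ * expect (d s) k) (s : S) :
    k s ≤ chainLaw d s {ρ | ∃ n, ρ n ∈ G} := by
  have hm : MeasurableSet {ρ : ℕ → S | ∃ n, ρ n ∈ G} := by
    simpa using measurableSet_exists_mem G fun _ => True
  have key : ∀ n : ℕ, ∀ s, k s ≤ γ ^ n + chainLaw d s {ρ | ∃ n, ρ n ∈ G} := by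
    intro n
    induction n with
    | zero => intro s; exact (hk1 s).trans (by simp)
    | succ n ih =>
      intro s
      by_cases hs : s ∈ G
      · rw [chainLaw_prob_eq_one_of_mem d hm fun ρ => ⟨0, hs⟩]
        exact (hk1 s).trans le_add_self
      · refine (hk s hs).trans ((mul_le_mul_right (expect_mono ih) _).trans ?_)
        rw [expect_add _ (fun _ => γ ^ n), expect_const, mul_add, pow_succ', chainLaw_apply d s hm]
        refine add_le_add_right ((mul_le_of_le_one_left zero_le hγ.le).trans ?_) _
        refine expect_mono fun t => measure_mono ?_
        rintro ρ ⟨n, hn⟩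
        exact ⟨n + 1, hn⟩
  have hl : Tendsto (fun n : ℕ => γ ^ n + chainLaw d s {ρ | ∃ n, ρ n ∈ G}) atTop
      (nhds (0 + chainLaw d s {ρ | ∃ n, ρ n ∈ G})) :=
    (ENNReal.tendsto_pow_atTop_nhds_zero_of_lt_one hγ).add_const _
  rw [zero_add] at hl
  exact ge_of_tendsto' hl fun n => key n s

/-- If `G` is reached from every state with probability at least `a > 0`, then it is reached
infinitely often almost surely. -/
lemma ae_frequently_mem {d : S → PMF S} {G : Set S} {a : ℝ≥0∞} (ha : a ≠ 0)
    (h : ∀ s, a ≤ chainLaw d s {ρ | ∃ n, ρ n ∈ G}) (s : S) :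
    ∀ᵐ ρ ∂chainLaw d s, ∃ᶠ n in atTop, ρ n ∈ G := by
  have hm : MeasurableSet {ρ : ℕ → S | ∃ n, ρ n ∈ G} := by
    simpa using measurableSet_exists_mem G fun _ => True
  have h0 : ∀ s, chainLaw d s {ρ | ∃ n, ρ n ∈ G}ᶜ = 0 := by
    refine chainLaw_eq_zero_of_le hm.compl (fun s ρ hρ => ?_) (c := 1 - a)
      (ENNReal.sub_lt_self ENNReal.one_ne_top one_ne_zero ha) fun s => ?_
    · rintro ⟨n, hn⟩
      exact hρ ⟨n + 1, hn⟩
    · rw [prob_compl_eq_one_sub hm]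
      exact tsub_le_tsub_left (h s) _
  have hn : ∀ n : ℕ, ∀ s, chainLaw d s {ρ | ∀ m, n ≤ m → ρ m ∈ Gᶜ} = 0 := by
    intro n
    induction n with
    | zero =>
      intro s
      rw [← h0 s]
      congr 1
      ext ρ
      simp
    | succ n ih =>
      intro s
      rw [chainLaw_apply d s (measurableSet_forall_mem _ _), ← expect_const (d s) 0]
      congr 1
      funext t
      refine le_antisymm ((measure_mono fun ρ hρ m hm => ?_).trans (ih t).le) zero_le
      exact hρ (m + 1) (by omega)
  have : ∀ᵐ ρ ∂chainLaw d s, ∀ n, ρ ∉ {ρ : ℕ → S | ∀ m, n ≤ m → ρ m ∈ Gᶜ} :=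
    ae_all_iff.2 fun n => measure_eq_zero_iff_ae_notMem.1 (hn n s)
  filter_upwards [this] with ρ hρ
  rw [frequently_atTop]
  intro n
  have := hρ n
  simp only [Set.mem_compl_iff] at this
  push Not at this
  exact this

/-- A subharmonic function that vanishes on `B` is a lower bound of the probability to avoid `B`. -/
lemma le_chainLaw_forall_notMem {d : S → PMF S} {B : Set S} {k : S → ℝ≥0∞}
    (hk1 : ∀ s, k s ≤ 1) (hk0 : ∀ s ∈ B, k s = 0) (hk : ∀ s, k s ≤ expect (d s) k) (s : S) :
    k s ≤ chainLaw d s {ρ | ∀ n, ρ n ∈ Bᶜ} := by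
  have key : ∀ n : ℕ, ∀ s, k s ≤ chainLaw d s {ρ | ∀ i, i < n → ρ i ∈ Bᶜ} := by
    intro n
    induction n with
    | zero => intro s; simpa using hk1 s
    | succ n ih =>
      intro s
      by_cases hs : s ∈ B
      · rw [hk0 s hs]; exact zero_le
      · refine (hk s).trans ((expect_mono ih).trans ?_)
        rw [chainLaw_apply d s (measurableSet_forall_mem _ _)]
        refine expect_mono fun t => measure_mono fun ρ hρ i hi => ?_
        cases i with
        | zero => exact hs
        | succ i => exact hρ i (by omega)
  have : {ρ : ℕ → S | ∀ n, ρ n ∈ Bᶜ} = ⋂ n, {ρ | ∀ i, i < n → ρ i ∈ Bᶜ} := by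
    ext ρ
    simp only [Set.mem_ofPred_eq, Set.mem_iInter]
    exact ⟨fun h _ i _ => h i, fun h n => h (n + 1) n (by omega)⟩
  rw [this, Antitone.measure_iInter]
  · exact le_iInf fun n => key n s
  · exact fun n m hnm ρ hρ i hi => hρ i (hi.trans_le hnm)
  · exact fun n => (measurableSet_forall_mem _ _).nullMeasurableSet
  · exact ⟨0, measure_ne_top _ _⟩

lemma ae_forall_mem {d : S → PMF S} {W : Set S} (hW : ∀ s ∈ W, ∀ t, d s t ≠ 0 → t ∈ W) {s : S}
    (hs : s ∈ W) : ∀ᵐ ρ ∂chainLaw d s, ∀ n, ρ n ∈ W := by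
  refine ae_all_iff.2 fun n => ?_
  change chainLaw d s {ρ | ρ n ∈ Wᶜ} = 0
  induction n generalizing s with
  | zero =>
    rw [chainLaw_apply d s (measurableSet_coord _ _), ← expect_const (d s) 0]
    congr 1
    funext t
    have : consRun s ⁻¹' {ρ | ρ 0 ∈ Wᶜ} = ∅ := by
      ext ρ; simp [hs]
    rw [this, measure_empty]
  | succ n ih =>
    rw [chainLaw_apply d s (measurableSet_coord _ _)]
    refine le_antisymm (expect_le fun t ht => ?_) zero_le
    exact (ih (hW s hs t ht)).le

/-- If `T ∪ D` is visited infinitely often, infinitely many visits of `T` and avoiding `B` both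
imply the tail objective `φ`, and in states of `D` the set `B` is avoided with probability bounded away
from zero, then the objective `φ` holds almost surely. -/
lemma chainLaw_eq_one {d : S → PMF S} {T D W B : Set S} {φ : Set (ℕ → S)} (hφm : MeasurableSet φ)
    (hφ : ∀ s ρ, consRun s ρ ∈ φ ↔ ρ ∈ φ) (hφB : ∀ ρ : ℕ → S, (∀ n, ρ n ∈ Bᶜ) → ρ ∈ φ)
    (hφT : ∀ ρ : ℕ → S, (∃ᶠ n in atTop, ρ n ∈ T) → ρ ∈ φ)
    (hW : ∀ s ∈ W, ∀ t, d s t ≠ 0 → t ∈ W)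
    (hG : ∀ s, ∀ᵐ ρ ∂chainLaw d s, ∃ᶠ n in atTop, ρ n ∈ T ∪ D ∪ Wᶜ) {c : ℝ≥0∞} (hc : c ≠ 0)
    (hD : ∀ s ∈ D, c ≤ chainLaw d s {ρ | ∀ n, ρ n ∈ Bᶜ}) {s : S} (hs : s ∈ W) :
    chainLaw d s φ = 1 := by
  set N : Set (ℕ → S) := φᶜ ∩ {ρ | ∀ n, ρ n ∈ W} with hNdef
  have hWm : MeasurableSet {ρ : ℕ → S | ∀ n, ρ n ∈ W} := by
    simpa using measurableSet_forall_mem W fun _ => True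
  have hBm : MeasurableSet {ρ : ℕ → S | ∀ n, ρ n ∈ Bᶜ} := by
    simpa using measurableSet_forall_mem Bᶜ fun _ => True
  have hNm : MeasurableSet N := hφm.compl.inter hWm
  have hsuf : ∀ s ρ, consRun s ρ ∈ N → ρ ∈ N := fun s ρ hρ =>
    ⟨fun h => hρ.1 ((hφ s ρ).2 h), fun n => hρ.2 (n + 1)⟩
  -- Decomposition at the first visit to `D`: until then only suffixes are taken, and at the visit
  -- avoiding `B` would contradict `N ⊆ φᶜ`.
  have hm : ∀ m : ℕ, ∀ s, chainLaw d s (N ∩ {ρ | ∃ n, n < m ∧ ρ n ∈ D}) ≤ 1 - c := by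
    intro m
    induction m with
    | zero => intro s; simp
    | succ m ih =>
      intro s
      by_cases hsD : s ∈ D
      · refine (measure_mono (t := {ρ : ℕ → S | ∀ n, ρ n ∈ Bᶜ}ᶜ)
          fun ρ hρ h => hρ.1.1 (hφB ρ h)).trans ?_
        rw [prob_compl_eq_one_sub hBm]
        exact tsub_le_tsub_left (hD s hsD) _
      · rw [chainLaw_apply d s (hNm.inter (measurableSet_exists_mem _ _))]
        refine expect_le fun t _ => (measure_mono ?_).trans (ih t)
        rintro ρ ⟨hρ, n, hn, hnD⟩
        refine ⟨hsuf s ρ hρ, ?_⟩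
        cases n with
        | zero => exact absurd hnD hsD
        | succ n => exact ⟨n, by omega, hnD⟩
  have hN : ∀ s, chainLaw d s N ≤ 1 - c := by
    intro s
    -- A run in `N` stays in `W` and cannot visit `T` infinitely often, so its infinitely many
    -- visits to the union must include one to `D`.
    have hsub : N ∩ {ρ | ∃ᶠ n in atTop, ρ n ∈ T ∪ D ∪ Wᶜ} ⊆
        ⋃ m, N ∩ {ρ | ∃ n, n < m ∧ ρ n ∈ D} := by
      rintro ρ ⟨hρ, hf⟩
      by_contra hcon
      refine hρ.1 (hφT ρ (hf.mono ?_))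
      rintro n ((h | h) | h)
      · exact h
      · exact (hcon (Set.mem_iUnion.2 ⟨n + 1, hρ, n, by omega, h⟩)).elim
      · exact absurd (hρ.2 n) h
    calc chainLaw d s N ≤ chainLaw d s (⋃ m, N ∩ {ρ | ∃ n, n < m ∧ ρ n ∈ D}) := by
          refine measure_mono_ae ?_
          filter_upwards [hG s] with ρ hρ
          exact fun h => hsub (Set.mem_inter h hρ)
      _ ≤ 1 - c := by
          rw [Monotone.measure_iUnion]
          · exact iSup_le fun m => hm m s
          · rintro m m' hmm ρ ⟨h1, n, h2, h3⟩
            exact ⟨h1, n, h2.trans_le hmm, h3⟩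
  have h0 := chainLaw_eq_zero_of_le hNm hsuf
    (ENNReal.sub_lt_self ENNReal.one_ne_top one_ne_zero hc) hN s
  rw [← prob_compl_eq_zero_iff hφm, measure_eq_zero_iff_ae_notMem]
  filter_upwards [measure_eq_zero_iff_ae_notMem.1 h0, ae_forall_mem hW hs] with ρ h1 h2 h3
  exact h1 ⟨h3, h2⟩

/-- Domination of the laws of Markov chains by means of a subharmonic density. -/
lemma mul_chainLaw_le {d d' : S → PMF S} {V : S → ℝ≥0∞} (hV : ∀ s, V s ≤ 1)
    (h : ∀ s t, V s * d s t ≤ d' s t * V t) (s : S) {A : Set (ℕ → S)} (hA : MeasurableSet A) :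
    V s * chainLaw d s A ≤ chainLaw d' s A := by
  -- Along a finite path the hypothesis telescopes: `V` at the start times the `d`-probability is at
  -- most the `d'`-probability times `V` at the end, and `V ≤ 1`.
  have key : ∀ n, ∀ C : Set (ℕ → S), MeasurableSet C →
      (∀ ρ ρ' : ℕ → S, (∀ i < n, ρ i = ρ' i) → ρ ∈ C → ρ' ∈ C) →
      ∀ s, V s * chainLaw d s C ≤ chainLaw d' s C := by
    intro n
    induction n with
    | zero =>
      intro C _ hC s
      rcases C.eq_empty_or_nonempty with rfl | ⟨ρ, hρ⟩
      · simp
      · have : C = Set.univ := Set.eq_univ_of_forall fun ρ' => hC ρ ρ' (by simp) hρ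
        simpa [this] using hV s
    | succ n ih =>
      intro C hCm hC s
      rw [chainLaw_apply d s hCm, chainLaw_apply d' s hCm, expect, expect, ← ENNReal.tsum_mul_left]
      refine ENNReal.tsum_le_tsum fun t => ?_
      rw [← mul_assoc]
      refine (mul_le_mul_left (h s t) _).trans ?_
      rw [mul_assoc]
      exact mul_le_mul_right (ih _ (hCm.preimage (measurable_consRun s))
        (preimage_consRun_dependsOn hC s) t) _
  refine ENNReal.le_of_forall_pos_le_add fun δ hδ _ => ?_
  obtain ⟨C, hCm, ⟨n, hC⟩, hlt⟩ := exists_dependsOn_symmDiff_lt (chainLaw d s + chainLaw d' s) hA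
    (ε := (δ : ℝ≥0∞) / 2) (by simpa using hδ.ne')
  rw [Measure.add_apply] at hlt
  have h1 := (measure_le_add_of_symmDiff (le_self_add.trans hlt.le)).1
  have h2 := (measure_le_add_of_symmDiff (le_add_self.trans hlt.le)).2
  calc V s * chainLaw d s A ≤ V s * (chainLaw d s C + δ / 2) := mul_le_mul_right h1 _
    _ ≤ chainLaw d' s C + δ / 2 := by
        rw [mul_add]
        exact add_le_add (key n C hCm hC s) (mul_le_of_le_one_left zero_le (hV s))
    _ ≤ (chainLaw d' s A + δ / 2) + δ / 2 := add_le_add_left h2 _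
    _ = chainLaw d' s A + δ := by rw [add_assoc, ENNReal.add_halves]

end Chain

lemma expect_lt_expect {S : Type*} {p : PMF S} {x y : S → ℝ≥0∞} (hx : expect p x ≠ ⊤)
    (h : ∀ t, p t ≠ 0 → x t ≤ y t) {t : S} (ht : p t ≠ 0) (hlt : x t < y t) :
    expect p x < expect p y := by
  refine ENNReal.tsum_lt_tsum (i := t) hx (fun u => ?_)
    ((ENNReal.mul_lt_mul_iff_right ht (p.apply_ne_top t)).2 hlt)
  rcases eq_or_ne (p u) 0 with h0 | h0
  · simp [h0]
  · exact mul_le_mul_right (h u h0) _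

/-- Identifies the state entered by the first move of a glued strategy, which selects the
continuation. -/
lemma headD_eq_of_head?_append {S : Type*} {w : List S} {u t : S}
    (h : (w ++ [u]).head? = some t) : w.headD u = t := by
  cases w with
  | nil => exact Option.some.inj h
  | cons a w => exact Option.some.inj h

/-! ### One-step choices, shifted strategies and glued strategies. -/

section Available

variable {S : Type*} {M : MDP S}

/-- The distributions that a strategy can realize in the state `s`. -/
def available (M : MDP S) (s : S) : Set (PMF S) :=
  {p | (s ∈ M.controlled → ∀ t ∈ p.support, M.trans s t) ∧
    ∀ h : s ∉ M.controlled, p = M.prob ⟨s, h⟩}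

lemma trans_of_available {s : S} {p : PMF S} (hp : p ∈ M.available s) {t : S} (ht : p t ≠ 0) :
    M.trans s t := by
  by_cases h : s ∈ M.controlled
  · exact hp.1 h t ht
  · rw [hp.2 h] at ht
    exact M.prob_support ⟨s, h⟩ t ht

lemma Strategy.step_of_controlled (σ : M.Strategy) (w : List S) {s : S} (h : s ∈ M.controlled) :
    σ.step w s = σ.act w ⟨s, h⟩ := dif_pos h

lemma Strategy.step_of_random (σ : M.Strategy) (w : List S) {s : S} (h : s ∉ M.controlled) :
    σ.step w s = M.prob ⟨s, h⟩ := dif_neg h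

lemma Strategy.step_mem_available (σ : M.Strategy) (w : List S) (s : S) :
    σ.step w s ∈ M.available s := by
  refine ⟨fun h => ?_, fun h => σ.step_of_random w h⟩
  rw [σ.step_of_controlled w h]
  exact σ.act_support w ⟨s, h⟩

lemma pure_mem_available {s t : S} (hs : s ∈ M.controlled) (ht : M.trans s t) :
    PMF.pure t ∈ M.available s := by
  refine ⟨fun _ u hu => ?_, fun h => absurd hs h⟩
  rw [PMF.support_pure, Set.mem_singleton_iff] at hu
  exact hu ▸ ht

/-- The strategy `σ` after a visit of the state `s`. -/
def Strategy.shift (σ : M.Strategy) (s : S) : M.Strategy where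
  act w := σ.act (s :: w)
  act_support w := σ.act_support (s :: w)

lemma Strategy.step_shift (σ : M.Strategy) (s : S) (w : List S) :
    (σ.shift s).step w = σ.step (s :: w) := rfl

instance : Nonempty M.Strategy :=
  ⟨{ act := fun _ s => PMF.pure (M.exists_succ s).choose
     act_support := fun _ s t ht => by
      rw [PMF.support_pure, Set.mem_singleton_iff] at ht
      exact ht ▸ (M.exists_succ s).choose_spec }⟩

open Classical in
/-- The strategy that first moves from `s` according to `p` and, after a move to `t`, continues with
the strategy `τ t`. -/
noncomputable def Strategy.glue {s : S} {p : PMF S} (hp : p ∈ M.available s) (τ : S → M.Strategy) :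
    M.Strategy where
  act w u := match w with
    | [] => if u.1 = s then p else PMF.pure (M.exists_succ u).choose
    -- `w.headD u` is the second state of the whole history; when `w` is empty it is the current
    -- state `u`.
    | _ :: w => (τ (w.headD u)).act w u
  act_support w u t ht := by
    cases w with
    | nil =>
      dsimp only at ht
      split_ifs at ht with h
      · exact h ▸ hp.1 (h ▸ u.2) t ht
      · rw [PMF.support_pure, Set.mem_singleton_iff] at ht
        exact ht ▸ (M.exists_succ u).choose_spec
    | cons a w => exact (τ (w.headD u)).act_support w u t ht

lemma Strategy.step_glue_nil {s : S} {p : PMF S} (hp : p ∈ M.available s) (τ : S → M.Strategy) :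
    (Strategy.glue hp τ).step [] s = p := by
  by_cases h : s ∈ M.controlled
  · rw [Strategy.step_of_controlled _ _ h]
    exact if_pos rfl
  · rw [Strategy.step_of_random _ _ h, hp.2 h]

lemma Strategy.step_glue_cons {s : S} {p : PMF S} (hp : p ∈ M.available s) (τ : S → M.Strategy)
    (a : S) (w : List S) (u : S) :
    (Strategy.glue hp τ).step (a :: w) u = (τ (w.headD u)).step w u := by
  by_cases h : u ∈ M.controlled
  · rw [Strategy.step_of_controlled _ _ h, Strategy.step_of_controlled _ _ h]
    rfl
  · rw [Strategy.step_of_random _ _ h, Strategy.step_of_random _ _ h]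

end Available

/-! ### Values of tail objectives and the process conditioned on the objective. -/

section Values

variable {S : Type*} [Countable S] [MeasurableSpace S] [DiscreteMeasurableSpace S] {M : MDP S}
  {φ : Set (ℕ → S)}

instance (σ : M.Strategy) (s : S) : IsProbabilityMeasure (σ.runMeasure s) :=
  inferInstanceAs (IsProbabilityMeasure (processLaw σ.step s))

lemma Strategy.runMeasure_apply (σ : M.Strategy) (s : S) {A : Set (ℕ → S)}
    (hA : MeasurableSet A) :
    σ.runMeasure s A =
      expect (σ.step [] s) fun t => (σ.shift s).runMeasure t (consRun s ⁻¹' A) :=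
  processLaw_apply _ _ hA

lemma runMeasure_le_value (σ : M.Strategy) (φ : Set (ℕ → S)) (s : S) :
    σ.runMeasure s φ ≤ M.value φ s :=
  le_iSup (fun τ : M.Strategy => τ.runMeasure s φ) σ

lemma value_le_one (φ : Set (ℕ → S)) (s : S) : M.value φ s ≤ 1 :=
  iSup_le fun _ => prob_le_one

lemma value_ne_top (φ : Set (ℕ → S)) (s : S) : M.value φ s ≠ ⊤ :=
  ne_top_of_le_ne_top ENNReal.one_ne_top (value_le_one φ s)

lemma Strategy.runMeasure_glue {s : S} {p : PMF S} (hp : p ∈ M.available s) (τ : S → M.Strategy)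
    {A : Set (ℕ → S)} (hA : MeasurableSet A) :
    (Strategy.glue hp τ).runMeasure s A =
      expect p fun t => (τ t).runMeasure t (consRun s ⁻¹' A) := by
  rw [Strategy.runMeasure_apply _ _ hA, Strategy.step_glue_nil]
  refine congrArg (expect p) (funext fun t => ?_)
  have : processLaw ((Strategy.glue hp τ).shift s).step t = processLaw (τ t).step t := by
    refine processLaw_congr fun w u h => ?_
    rw [Strategy.step_shift, Strategy.step_glue_cons]
    rw [headD_eq_of_head?_append h]
  rw [Strategy.runMeasure_eq_processLaw, Strategy.runMeasure_eq_processLaw, this]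

lemma exists_strategy_value_le (φ : Set (ℕ → S)) (s : S) {δ : ℝ≥0∞} (hδ : δ ≠ 0) :
    ∃ σ : M.Strategy, M.value φ s ≤ σ.runMeasure s φ + δ := by
  rcases eq_or_ne (M.value φ s) 0 with h | h
  · exact ⟨Classical.arbitrary _, by simp [h]⟩
  · have hlt : M.value φ s - δ < M.value φ s := ENNReal.sub_lt_self (value_ne_top φ s) h hδ
    obtain ⟨σ, hσ⟩ := lt_iSup_iff.1 (show _ < ⨆ σ : M.Strategy, σ.runMeasure s φ from hlt)
    exact ⟨σ, tsub_le_iff_right.1 hσ.le⟩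

/-- For a tail objective, the value function is superharmonic. -/
lemma expect_value_le (hφm : MeasurableSet φ) (hφ : ∀ s ρ, consRun s ρ ∈ φ ↔ ρ ∈ φ) {s : S}
    {p : PMF S} (hp : p ∈ M.available s) : expect p (M.value φ) ≤ M.value φ s := by
  refine ENNReal.le_of_forall_pos_le_add fun δ hδ _ => ?_
  choose τ hτ using fun t => exists_strategy_value_le (M := M) φ t (δ := δ) (by simpa using hδ.ne')
  have hpre : ∀ s, consRun s ⁻¹' φ = φ := fun s => Set.ext fun ρ => hφ s ρ
  calc expect p (M.value φ) ≤ expect p (fun t => (τ t).runMeasure t φ + δ) := expect_mono hτ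
    _ = (Strategy.glue hp τ).runMeasure s φ + δ := by
        rw [expect_add p (fun t => (τ t).runMeasure t φ), expect_const,
          Strategy.runMeasure_glue hp τ hφm, hpre]
    _ ≤ M.value φ s + δ := add_le_add_left (runMeasure_le_value _ _ _) _

lemma value_le_of_trans (hφm : MeasurableSet φ) (hφ : ∀ s ρ, consRun s ρ ∈ φ ↔ ρ ∈ φ) {s t : S}
    (hs : s ∈ M.controlled) (hst : M.trans s t) : M.value φ t ≤ M.value φ s := by
  have := expect_value_le hφm hφ (pure_mem_available hs hst)
  rwa [expect_pure] at this

/-- An optimal strategy for a tail objective stays optimal, and preserves the expected value. -/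
lemma Strategy.IsOptimalFrom.step (hφm : MeasurableSet φ)
    (hφ : ∀ s ρ, consRun s ρ ∈ φ ↔ ρ ∈ φ) {σ : M.Strategy} {s : S} (hσ : σ.IsOptimalFrom φ s) :
    expect (σ.step [] s) (M.value φ) = M.value φ s ∧
      ∀ t, σ.step [] s t ≠ 0 → (σ.shift s).IsOptimalFrom φ t := by
  have hpre : consRun s ⁻¹' φ = φ := Set.ext fun ρ => hφ s ρ
  have h1 : M.value φ s ≤ expect (σ.step [] s) fun t => (σ.shift s).runMeasure t φ := by
    have := σ.runMeasure_apply s hφm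
    rw [hpre] at this
    exact this ▸ hσ
  have h2 := expect_value_le hφm hφ (σ.step_mem_available [] s)
  have h3 : ∀ t, (σ.shift s).runMeasure t φ ≤ M.value φ t := fun t => runMeasure_le_value _ _ _
  refine ⟨le_antisymm h2 (h1.trans (expect_mono h3)), fun t ht => ?_⟩
  by_contra hlt
  refine absurd (expect_lt_expect ?_ (fun t _ => h3 t) ht (not_le.1 hlt)) (not_lt.2 (h2.trans h1))
  exact ne_top_of_le_ne_top (value_ne_top φ s) ((expect_mono h3).trans h2)

/-- From a controlled state no successor has a larger value, while the average under an optimal move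
equals the value; so no successor in the support can have a smaller one. -/
lemma Strategy.IsOptimalFrom.value_eq (hφm : MeasurableSet φ)
    (hφ : ∀ s ρ, consRun s ρ ∈ φ ↔ ρ ∈ φ) {σ : M.Strategy} {s : S} (hσ : σ.IsOptimalFrom φ s)
    (hs : s ∈ M.controlled) {t : S} (ht : σ.step [] s t ≠ 0) : M.value φ t = M.value φ s := by
  have hle : ∀ t, σ.step [] s t ≠ 0 → M.value φ t ≤ M.value φ s := fun t ht =>
    value_le_of_trans hφm hφ hs (trans_of_available (σ.step_mem_available [] s) ht)
  by_contra hne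
  have h1 := (hσ.step hφm hφ).1
  have h2 := expect_lt_expect (y := fun _ => M.value φ s) (h1 ▸ value_ne_top φ s) hle ht
    (lt_of_le_of_ne (hle t ht) hne)
  rw [h1, expect_const] at h2
  exact h2.false

/-- The states of positive value with an optimal strategy. -/
def goodStates (M : MDP S) (φ : Set (ℕ → S)) : Set S :=
  {s | s ∈ M.optStates φ ∧ M.value φ s ≠ 0}

/-- The distributions available in the decision process that is conditioned on the objective `φ`:
on the good states, the choices have to preserve the value, and the probabilities are weighted by
the value. -/
def conditioned (M : MDP S) (φ : Set (ℕ → S)) (s : S) : Set (PMF S) :=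
  {p | (s ∈ M.controlled → ∃ t, M.trans s t ∧ p = PMF.pure t ∧
      (s ∈ M.goodStates φ → t ∈ M.goodStates φ ∧ M.value φ t = M.value φ s)) ∧
    ∀ h : s ∉ M.controlled, (s ∉ M.goodStates φ → p = M.prob ⟨s, h⟩) ∧
      (s ∈ M.goodStates φ → ∀ t, M.value φ s * p t = M.prob ⟨s, h⟩ t * M.value φ t)}

lemma Strategy.IsOptimalFrom.mem_goodStates (hφm : MeasurableSet φ)
    (hφ : ∀ s ρ, consRun s ρ ∈ φ ↔ ρ ∈ φ) {σ : M.Strategy} {s : S} (hσ : σ.IsOptimalFrom φ s)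
    {t : S} (ht : σ.step [] s t ≠ 0) (h0 : M.value φ t ≠ 0) : t ∈ M.goodStates φ :=
  ⟨⟨_, (hσ.step hφm hφ).2 t ht⟩, h0⟩

lemma conditioned_nonempty (hφm : MeasurableSet φ) (hφ : ∀ s ρ, consRun s ρ ∈ φ ↔ ρ ∈ φ) (s : S) :
    (M.conditioned φ s).Nonempty := by
  by_cases hg : s ∈ M.goodStates φ
  · obtain ⟨⟨σ, hσ⟩, h0⟩ := hg
    by_cases hs : s ∈ M.controlled
    · obtain ⟨t, ht⟩ := (σ.step [] s).support_nonempty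
      rw [PMF.mem_support_iff] at ht
      have hv := hσ.value_eq hφm hφ hs ht
      exact ⟨PMF.pure t, fun _ => ⟨t, trans_of_available (σ.step_mem_available [] s) ht, rfl,
        fun _ => ⟨hσ.mem_goodStates hφm hφ ht (by rw [hv]; exact h0), hv⟩⟩, fun h => absurd hs h⟩
    · have hE := (hσ.step hφm hφ).1
      rw [σ.step_of_random [] hs] at hE
      refine ⟨⟨fun t => (M.value φ s)⁻¹ * (M.prob ⟨s, hs⟩ t * M.value φ t), ?_⟩,
        fun h => absurd h hs, fun h => ⟨fun h' => absurd ⟨⟨σ, hσ⟩, h0⟩ h', fun _ t => ?_⟩⟩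
      · rw [ENNReal.summable.hasSum_iff, ENNReal.tsum_mul_left]
        change _ * expect _ _ = _
        rw [hE, ENNReal.inv_mul_cancel h0 (value_ne_top φ s)]
      · change M.value φ s * ((M.value φ s)⁻¹ * (M.prob ⟨s, hs⟩ t * M.value φ t)) = _
        rw [← mul_assoc, ENNReal.mul_inv_cancel h0 (value_ne_top φ s), one_mul]
  · by_cases hs : s ∈ M.controlled
    · obtain ⟨t, ht⟩ := M.exists_succ s
      exact ⟨PMF.pure t, fun _ => ⟨t, ht, rfl, fun h => absurd h hg⟩, fun h => absurd hs h⟩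
    · exact ⟨M.prob ⟨s, hs⟩, fun h => absurd h hs, fun _ => ⟨fun _ => rfl, fun h => absurd h hg⟩⟩

lemma trans_of_conditioned {s : S} {p : PMF S} (hp : p ∈ M.conditioned φ s) {t : S}
    (ht : p t ≠ 0) : M.trans s t := by
  by_cases hs : s ∈ M.controlled
  · obtain ⟨u, hu, rfl, _⟩ := hp.1 hs
    have : t = u := by simpa [PMF.pure_apply] using ht
    exact this ▸ hu
  · refine M.prob_support ⟨s, hs⟩ t ?_
    rw [PMF.mem_support_iff]
    by_cases hg : s ∈ M.goodStates φ
    · intro h0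
      have := (hp.2 hs).2 hg t
      rw [h0, zero_mul] at this
      exact (mul_ne_zero hg.2 ht) this
    · rwa [← (hp.2 hs).1 hg]

lemma mem_goodStates_of_conditioned (hφm : MeasurableSet φ)
    (hφ : ∀ s ρ, consRun s ρ ∈ φ ↔ ρ ∈ φ) {s : S} (hg : s ∈ M.goodStates φ) {p : PMF S}
    (hp : p ∈ M.conditioned φ s) {t : S} (ht : p t ≠ 0) : t ∈ M.goodStates φ := by
  by_cases hs : s ∈ M.controlled
  · obtain ⟨u, _, rfl, hu⟩ := hp.1 hs
    have : t = u := by simpa [PMF.pure_apply] using ht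
    exact this ▸ (hu hg).1
  · obtain ⟨⟨σ, hσ⟩, h0⟩ := hg
    have := (hp.2 hs).2 ⟨⟨σ, hσ⟩, h0⟩ t
    have hne := this ▸ mul_ne_zero h0 ht
    refine hσ.mem_goodStates hφm hφ ?_ (right_ne_zero_of_mul hne)
    rw [σ.step_of_random [] hs]
    exact left_ne_zero_of_mul hne

/-- The one-step change of measure: an optimal move weighted by the value becomes a move of the
conditioned process. At a controlled state a randomized move is an average of value-preserving Dirac
moves, so the best of these is at least as good. -/
lemma expect_value_mul_le (hφm : MeasurableSet φ) (hφ : ∀ s ρ, consRun s ρ ∈ φ ↔ ρ ∈ φ)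
    {σ : M.Strategy} {s : S} (hσ : σ.IsOptimalFrom φ s) (h0 : M.value φ s ≠ 0) (x : S → ℝ≥0∞) :
    expect (σ.step [] s) (fun t => M.value φ t * x t) ≤
      M.value φ s * bestExpect (M.conditioned φ) x s := by
  by_cases hs : s ∈ M.controlled
  · refine expect_le fun t ht => ?_
    have hv := hσ.value_eq hφm hφ hs ht
    rw [hv, ← expect_pure t x]
    refine mul_le_mul_right (expect_le_bestExpect ?_ x) _
    exact ⟨fun _ => ⟨t, trans_of_available (σ.step_mem_available [] s) ht, rfl,
      fun _ => ⟨hσ.mem_goodStates hφm hφ ht (by rw [hv]; exact h0), hv⟩⟩, fun h => absurd hs h⟩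
  · obtain ⟨p, hp⟩ := conditioned_nonempty (M := M) hφm hφ s
    refine le_trans (le_of_eq ?_) (mul_le_mul_right (expect_le_bestExpect hp x) _)
    rw [σ.step_of_random [] hs, expect, expect, ← ENNReal.tsum_mul_left]
    refine tsum_congr fun t => ?_
    rw [← mul_assoc, ← mul_assoc, (hp.2 hs).2 ⟨⟨σ, hσ⟩, h0⟩ t]

/-- In the conditioned process it is possible to reach almost surely a set `G` that contains the
target `T` and the states with a large probability to avoid `B`, if almost every run in `φ` that
misses `T` eventually avoids `B`. -/
lemma reachValue_conditioned_eq_one (hφm : MeasurableSet φ)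
    (hφ : ∀ s ρ, consRun s ρ ∈ φ ↔ ρ ∈ φ) {B T G : Set S}
    (hB : ∀ ρ ∈ φ, (∀ n, ρ n ∉ T) → ∃ m, ∀ n, m ≤ n → ρ n ∉ B) (hTG : T ⊆ G)
    (hDG : ∀ s, 2⁻¹ ≤ safeValue (M.conditioned φ) B s → s ∈ G)
    (hWG : ∀ s, s ∉ M.goodStates φ → s ∈ G) (s : S) :
    reachValue 1 (M.conditioned φ) G s = 1 := by
  set r := reachValue 1 (M.conditioned φ) G with hr
  have hpre : ∀ s, consRun s ⁻¹' φ = φ := fun s => Set.ext fun ρ => hφ s ρ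
  have hGm : MeasurableSet {ρ : ℕ → S | ∀ n, ρ n ∈ Gᶜ} := by
    simpa using measurableSet_forall_mem Gᶜ fun _ => True
  let Q : ℕ → Set (ℕ → S) := fun m =>
    (φ ∩ {ρ | ∀ n, m ≤ n → ρ n ∈ Bᶜ}) ∩ {ρ | ∀ n, ρ n ∈ Gᶜ}
  have hQm : ∀ m, MeasurableSet (Q m) := fun m =>
    (hφm.inter (measurableSet_forall_mem _ _)).inter hGm
  have hQφ : ∀ m, Q m ⊆ φ := fun m ρ h => h.1.1
  have hQs : ∀ m s, consRun s ⁻¹' Q m ⊆ Q (m - 1) := fun m s ρ h =>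
    ⟨⟨(hφ s ρ).1 h.1.1, fun n hn => h.1.2 (n + 1) (by omega)⟩, fun n => h.2 (n + 1)⟩
  -- The best probability, conditional on `φ`, that an optimal strategy avoids `B` forever without
  -- entering `G`. It is subharmonic in the conditioned process, since optimal strategies stay
  -- optimal after a step, and it vanishes on `B` and on `G`.
  set z : S → ℝ≥0∞ := fun s => ⨆ σ : M.Strategy, ⨆ _ : σ.IsOptimalFrom φ s ∧ M.value φ s ≠ 0,
    (M.value φ s)⁻¹ * σ.runMeasure s (Q 0) with hz
  have hle : ∀ (σ : M.Strategy) s, σ.IsOptimalFrom φ s →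
      σ.runMeasure s (Q 0) ≤ M.value φ s * z s := by
    intro σ s hσ
    rcases eq_or_ne (M.value φ s) 0 with h0 | h0
    · exact ((measure_mono (hQφ 0)).trans (runMeasure_le_value _ _ _)).trans (by simp [h0])
    · calc σ.runMeasure s (Q 0)
          = M.value φ s * ((M.value φ s)⁻¹ * σ.runMeasure s (Q 0)) := by
            rw [← mul_assoc, ENNReal.mul_inv_cancel h0 (value_ne_top φ s), one_mul]
        _ ≤ M.value φ s * z s := mul_le_mul_right (le_iSup₂ (f := fun (σ : M.Strategy)
            (_ : σ.IsOptimalFrom φ s ∧ M.value φ s ≠ 0) =>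
              (M.value φ s)⁻¹ * σ.runMeasure s (Q 0)) σ ⟨hσ, h0⟩) _
  have hzero : ∀ s, (s ∈ B ∨ s ∈ G) → z s = 0 := by
    intro s hs
    refine le_antisymm (iSup₂_le fun σ _ => ?_) zero_le
    have : consRun s ⁻¹' Q 0 = ∅ := by
      refine Set.eq_empty_of_forall_notMem fun ρ hρ => ?_
      rcases hs with hs | hs
      · exact hρ.1.2 0 le_rfl hs
      · exact hρ.2 0 hs
    rw [σ.runMeasure_apply s (hQm 0), this]
    simp [expect_const]
  have hz0 : ∀ s, z s = 0 := by
    refine eq_zero_of_le_bestExpect (P := M.conditioned φ) (B := B)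
      (fun s hs => hzero s (Or.inl hs)) (fun s => iSup₂_le fun σ h => ?_) (fun s => iSup₂_le fun σ h => ?_)
      fun s hs => hzero s (Or.inr (hDG s hs))
    · rw [← ENNReal.inv_mul_cancel h.2 (value_ne_top φ s)]
      exact mul_le_mul_right ((measure_mono (hQφ 0)).trans (runMeasure_le_value _ _ _)) _
    · have h1 : σ.runMeasure s (Q 0) ≤ M.value φ s * bestExpect (M.conditioned φ) z s := by
        rw [σ.runMeasure_apply s (hQm 0)]
        refine le_trans (expect_mono_of_support fun t ht => ?_)
          (expect_value_mul_le hφm hφ h.1 h.2 z)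
        exact (measure_mono (hQs 0 s)).trans (hle _ t ((h.1.step hφm hφ).2 t ht))
      refine (mul_le_mul_right h1 _).trans_eq ?_
      rw [← mul_assoc, ENNReal.inv_mul_cancel h.2 (value_ne_top φ s), one_mul]
  have hQ0 : ∀ m, ∀ (σ : M.Strategy) s, σ.IsOptimalFrom φ s → σ.runMeasure s (Q m) = 0 := by
    intro m
    induction m with
    | zero =>
      intro σ s hσ
      have := hle σ s hσ
      rw [hz0, mul_zero] at this
      exact le_antisymm this zero_le
    | succ m ih =>
      intro σ s hσ
      rw [σ.runMeasure_apply s (hQm _)]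
      refine le_antisymm (expect_le fun t ht => ?_) zero_le
      exact (measure_mono (hQs (m + 1) s)).trans (ih _ t ((hσ.step hφm hφ).2 t ht)).le
  have hmiss : ∀ (σ : M.Strategy) s, σ.IsOptimalFrom φ s →
      σ.runMeasure s (φ ∩ {ρ | ∀ n, ρ n ∈ Gᶜ}) = 0 := by
    intro σ s hσ
    refine measure_mono_null (t := ⋃ m, Q m) ?_ (measure_iUnion_null fun m => hQ0 m σ s hσ)
    rintro ρ ⟨h1, h2⟩
    obtain ⟨m, hm⟩ := hB ρ h1 fun n hn => h2 n (hTG hn)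
    exact Set.mem_iUnion.2 ⟨m, ⟨h1, hm⟩, h2⟩
  -- The part of `φ` that hits `G` is bounded by the value times `r`. As the part missing `G` is
  -- null under an optimal strategy, the value is at most itself times `r`, whence `r = 1`.
  have hhit : ∀ m : ℕ, ∀ (σ : M.Strategy) s, σ.IsOptimalFrom φ s →
      σ.runMeasure s (φ ∩ {ρ | ∃ n, n < m ∧ ρ n ∈ G}) ≤ M.value φ s * r s := by
    intro m
    induction m with
    | zero => intro σ s _; simp
    | succ m ih =>
      intro σ s hσ
      by_cases hs : s ∈ G
      · rw [hr, reachValue_of_mem hs, mul_one]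
        exact (measure_mono Set.inter_subset_left).trans (runMeasure_le_value _ _ _)
      · have hg : s ∈ M.goodStates φ := by
          by_contra hg
          exact hs (hWG s hg)
        rw [σ.runMeasure_apply s (hφm.inter (measurableSet_exists_mem _ _)), hr,
          reachValue_of_notMem hs, one_mul]
        refine le_trans (expect_mono_of_support fun t ht => ?_)
          (expect_value_mul_le hφm hφ hσ hg.2 r)
        refine (measure_mono ?_).trans (ih _ t ((hσ.step hφm hφ).2 t ht))
        rintro ρ ⟨h1, n, h2, h3⟩
        refine ⟨(hφ s ρ).1 h1, ?_⟩
        cases n with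
        | zero => exact absurd h3 hs
        | succ n => exact ⟨n, by omega, h3⟩
  by_cases hs : s ∈ G
  · exact reachValue_of_mem hs
  have hg : s ∈ M.goodStates φ := by
    by_contra hg
    exact hs (hWG s hg)
  obtain ⟨⟨σ, hσ⟩, h0⟩ := hg
  refine le_antisymm (reachValue_le_one le_rfl s) ?_
  have hV : M.value φ s * 1 ≤ M.value φ s * r s := by
    rw [mul_one]
    calc M.value φ s ≤ σ.runMeasure s φ := hσ
      _ ≤ σ.runMeasure s ((⋃ m, φ ∩ {ρ | ∃ n, n < m ∧ ρ n ∈ G}) ∪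
            (φ ∩ {ρ | ∀ n, ρ n ∈ Gᶜ})) := by
          refine measure_mono fun ρ hρ => ?_
          by_cases h : ∃ n, ρ n ∈ G
          · obtain ⟨n, hn⟩ := h
            exact Or.inl (Set.mem_iUnion.2 ⟨n + 1, hρ, n, by omega, hn⟩)
          · exact Or.inr ⟨hρ, fun n hn => h ⟨n, hn⟩⟩
      _ ≤ σ.runMeasure s (⋃ m, φ ∩ {ρ | ∃ n, n < m ∧ ρ n ∈ G}) + 0 := by
          rw [← hmiss σ s hσ]
          exact measure_union_le _ _
      _ ≤ M.value φ s * r s := by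
          rw [add_zero, Monotone.measure_iUnion]
          · exact iSup_le fun m => hhit m σ s hσ
          · rintro m m' hmm ρ ⟨h1, n, h2, h3⟩
            exact ⟨h1, n, h2.trans_le hmm, h3⟩
  exact (ENNReal.mul_le_mul_iff_right h0 (value_ne_top φ s)).1 hV

end Values

/-! ### The parity objective with colors 0, 1, 2. -/

section Parity

variable {S : Type*} {col : S → ℕ}

lemma measurableSet_parity [MeasurableSpace S] [DiscreteMeasurableSpace S] (col : S → ℕ) :
    MeasurableSet (parity col) := by
  have : parity col = ⋃ i, ⋃ _ : Even i,
      (⋂ a, {ρ | ∃ n, a ≤ n ∧ ρ n ∈ {s | col s = i}}) ∩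
        ⋃ a, {ρ | ∀ n, a ≤ n → ρ n ∈ {s | col s ≤ i}} := by
    ext ρ
    simp only [parity, frequently_atTop, eventually_atTop, Set.mem_ofPred_eq, Set.mem_iUnion,
      Set.mem_inter_iff, Set.mem_iInter, exists_prop]
  rw [this]
  exact MeasurableSet.iUnion fun i => MeasurableSet.iUnion fun _ =>
    (MeasurableSet.iInter fun _ => measurableSet_exists_mem _ _).inter
      (MeasurableSet.iUnion fun _ => measurableSet_forall_mem _ _)

lemma consRun_mem_parity (s : S) (ρ : ℕ → S) : consRun s ρ ∈ parity col ↔ ρ ∈ parity col := by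
  have hf : ∀ p : S → Prop, (∃ᶠ n in atTop, p (consRun s ρ n)) ↔ ∃ᶠ n in atTop, p (ρ n) := by
    intro p
    conv_lhs => rw [← Filter.map_add_atTop_eq_nat 1]
    exact Filter.frequently_map
  have he : ∀ p : S → Prop, (∀ᶠ n in atTop, p (consRun s ρ n)) ↔ ∀ᶠ n in atTop, p (ρ n) := by
    intro p
    conv_lhs => rw [← Filter.map_add_atTop_eq_nat 1]
    exact Filter.eventually_map
  simp only [parity, Set.mem_ofPred_eq]
  refine exists_congr fun i => and_congr_right fun _ => and_congr ?_ ?_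
  · exact hf fun s => col s = i
  · exact he fun s => col s ≤ i

lemma mem_parity_of_frequently (hcol : ∀ s, col s ∈ ({0, 1, 2} : Set ℕ)) {ρ : ℕ → S}
    (h : ∃ᶠ n in atTop, ρ n ∈ {s | col s = 2}) : ρ ∈ parity col := by
  refine ⟨2, even_two, h, Eventually.of_forall fun n => ?_⟩
  rcases hcol (ρ n) with h | h | h
  · omega
  · omega
  · exact h.le

lemma mem_parity_of_forall (hcol : ∀ s, col s ∈ ({0, 1, 2} : Set ℕ)) {ρ : ℕ → S}
    (h : ∀ n, ρ n ∈ {s | col s = 1}ᶜ) : ρ ∈ parity col := by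
  by_cases h2 : ∃ᶠ n in atTop, ρ n ∈ {s | col s = 2}
  · exact mem_parity_of_frequently hcol h2
  · rw [not_frequently] at h2
    have h0 : ∀ᶠ n in atTop, col (ρ n) = 0 := by
      filter_upwards [h2] with n hn
      rcases hcol (ρ n) with h' | h' | h'
      · exact h'
      · exact absurd h' (h n)
      · exact absurd h' hn
    exact ⟨0, Even.zero, h0.frequently, h0.mono fun n hn => hn.le⟩

lemma eventually_of_mem_parity (hcol : ∀ s, col s ∈ ({0, 1, 2} : Set ℕ)) {ρ : ℕ → S}
    (h : ρ ∈ parity col) (h2 : ∀ n, ρ n ∉ {s | col s = 2}) :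
    ∃ m, ∀ n, m ≤ n → ρ n ∉ {s | col s = 1} := by
  obtain ⟨i, hi, hf, he⟩ := h
  obtain ⟨n, hn⟩ := hf.exists
  have hi0 : i = 0 := by
    rcases hcol (ρ n) with h' | h' | h'
    · omega
    · rw [h'] at hn
      exact absurd (hn ▸ hi) (by decide)
    · exact absurd h' (h2 n)
  subst hi0
  obtain ⟨m, hm⟩ := eventually_atTop.1 he
  refine ⟨m, fun n hn h' => ?_⟩
  have h3 := hm n hn
  have h4 : col (ρ n) = 1 := h'
  omega

end Parity

/-! ### The memoryless strategy in the acyclic case. -/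

variable {S : Type*} [Countable S] [MeasurableSpace S] [DiscreteMeasurableSpace S]

/-- In an acyclic decision process, a single memoryless deterministic strategy is optimal for the
`{0, 1, 2}`-parity objective from every state that has an optimal strategy. -/
theorem exists_memoryless_optimal (M : MDP S) (col : S → ℕ)
    (hcol : ∀ s, col s ∈ ({0, 1, 2} : Set ℕ)) (hM : M.Acyclic) :
    ∃ σ : M.Strategy, σ.IsMemoryless ∧ σ.IsDeterministic ∧
      ∀ s ∈ M.optStates (parity col), σ.IsOptimalFrom (parity col) s := by
  classical
  set φ := parity col with hφdef
  have hφm : MeasurableSet φ := measurableSet_parity col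
  have hφ : ∀ s ρ, consRun s ρ ∈ φ ↔ ρ ∈ φ := consRun_mem_parity
  set B : Set S := {s | col s = 1} with hB
  set T : Set S := {s | col s = 2} with hT
  set W := M.goodStates φ with hW
  set D : Set S := {s | 2⁻¹ ≤ safeValue (M.conditioned φ) B s} with hD
  set G : Set S := T ∪ D ∪ Wᶜ with hG
  have hne := conditioned_nonempty (M := M) hφm hφ
  have htrans : ∀ s, ∀ p ∈ M.conditioned φ s, ∀ t, p t ≠ 0 → M.trans s t :=
    fun s p hp t ht => trans_of_conditioned hp ht
  have hreach := reachValue_conditioned_eq_one (M := M) hφm hφ (B := B) (T := T) (G := G)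
    (fun ρ hρ h => eventually_of_mem_parity hcol hρ h) (fun s hs => Or.inl (Or.inl hs))
    (fun s hs => Or.inl (Or.inr hs)) (fun s hs => Or.inr hs)
  -- Safety is fixed first: its witness `k` stays subharmonic for every remaining choice, so the
  -- reachability choices cannot spoil it.
  obtain ⟨P, hP, hPsub, hPreach, k, hk1, hk0, hkD, hk⟩ := exists_safe_refinement hM hne htrans
    (B := B) (G := G) (fun s hs => Or.inl (Or.inr hs)) hreach
  obtain ⟨d, hdP, hd⟩ := exists_uniform_reach hM hP
    (fun s p hp => htrans s p (hPsub s hp)) hPreach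
  have hdc : ∀ s, d s ∈ M.conditioned φ s := fun s => hPsub s (hdP s)
  have hWclosed : ∀ s ∈ W, ∀ t, d s t ≠ 0 → t ∈ W := fun s hs t ht =>
    mem_goodStates_of_conditioned hφm hφ hs (hdc s) ht
  have hio : ∀ s, ∀ᵐ ρ ∂chainLaw d s, ∃ᶠ n in atTop, ρ n ∈ G := by
    refine ae_frequently_mem (a := 4⁻¹) (by simp) fun s => ?_
    obtain ⟨γ, hγ, k', hk1', hs, hk'⟩ := hd s
    exact hs.trans (le_chainLaw_exists_mem hγ hk1' hk' s)
  have hwin : ∀ s ∈ W, chainLaw d s φ = 1 := fun s hs =>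
    chainLaw_eq_one hφm hφ (fun ρ => mem_parity_of_forall hcol)
      (fun ρ => mem_parity_of_frequently hcol) hWclosed hio (c := 12⁻¹) (by simp)
      (fun s hs => (hkD s hs).trans
        (le_chainLaw_forall_notMem hk1 hk0 (fun s => hk s _ (hdP s)) s)) hs
  let σ : M.Strategy :=
    { act := fun _ s => d s
      act_support := fun _ s t ht => htrans s _ (hdc s) t ht }
  refine ⟨σ, ⟨fun s => d s, fun _ _ => rfl⟩, fun w s => ?_, fun s hs => ?_⟩
  · obtain ⟨t, _, ht, _⟩ := (hdc s).1 s.2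
    exact ⟨t, ht⟩
  by_cases h0 : M.value φ s = 0
  · exact h0.le.trans zero_le
  have hsW : s ∈ W := ⟨hs, h0⟩
  -- The density is the value on `W` and 0 elsewhere. Both cases hold with equality on `W` because
  -- the moves of `d` are conditioned moves: Dirac moves preserve the value, and random moves are
  -- reweighted by it.
  have hdom : ∀ s t, (if s ∈ W then M.value φ s else 0) * d s t ≤
      σ.step [] s t * if t ∈ W then M.value φ t else 0 := by
    intro s t
    by_cases hsW : s ∈ W
    · rcases eq_or_ne (d s t) 0 with h | h
      · simp [h]
      · rw [if_pos hsW, if_pos (hWclosed s hsW t h)]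
        by_cases hc : s ∈ M.controlled
        · rw [σ.step_of_controlled _ hc]
          obtain ⟨u, _, hu, hu'⟩ := (hdc s).1 hc
          have htu : t = u := by
            rw [hu] at h
            simpa [PMF.pure_apply] using h
          rw [htu, (hu' hsW).2, mul_comm]
        · rw [σ.step_of_random _ hc, ((hdc s).2 hc).2 hsW]
    · simp [hsW]
  have hle := mul_chainLaw_le (V := fun s => if s ∈ W then M.value φ s else 0)
    (fun s => by
      split_ifs
      exacts [value_le_one φ s, zero_le]) hdom s hφm
  simp only [hsW, if_true, hwin s hsW, mul_one] at hle
  exact hle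

lemma map_eq_self_of_support {α : Type*} {p : PMF α} {f : α → α}
    (h : ∀ a, p a ≠ 0 → f a = a) : p.map f = p := by
  conv_rhs => rw [← PMF.bind_pure p]
  rw [PMF.map]
  ext b
  rw [PMF.bind_apply, PMF.bind_apply]
  refine tsum_congr fun a => ?_
  rcases eq_or_ne (p a) 0 with h0 | h0
  · simp [h0]
  · rw [Function.comp_apply, h a h0]

lemma map_prodMk_apply {α : Type*} (p : PMF α) (n : ℕ) (x : α × ℕ) :
    p.map (fun t => (t, n)) x = if x.2 = n then p x.1 else 0 := by
  classical
  rw [PMF.map_apply]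
  split_ifs with h
  · rw [tsum_eq_single x.1]
    · exact if_pos (show x = (x.1, n) from Prod.ext rfl h)
    · intro t ht
      exact if_neg fun h' => ht (congrArg Prod.fst h').symm
  · rw [ENNReal.tsum_eq_zero]
    exact fun t => if_neg fun h' => h (congrArg Prod.snd h')

/-! ### Recording the time in the states: from memoryless to Markov strategies. -/

section Timed

variable {S : Type*} {M : MDP S}

/-- The decision process that also counts the number of transitions. -/
noncomputable def timed (M : MDP S) : MDP (S × ℕ) where
  controlled := {x | x.1 ∈ M.controlled}
  trans x y := M.trans x.1 y.1 ∧ y.2 = x.2 + 1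
  prob x := (M.prob ⟨x.1.1, x.2⟩).map fun t => (t, x.1.2 + 1)
  exists_succ x := by
    obtain ⟨t, ht⟩ := M.exists_succ x.1
    exact ⟨(t, x.2 + 1), ht, rfl⟩
  prob_support x y hy := by
    rw [PMF.mem_support_map_iff] at hy
    obtain ⟨t, ht, rfl⟩ := hy
    exact ⟨M.prob_support _ t ht, rfl⟩

lemma timed_acyclic (M : MDP S) : M.timed.Acyclic := by
  have : ∀ x y, Relation.TransGen M.timed.trans x y → x.2 < y.2 := by
    intro x y h
    induction h with
    | single h => exact h.2 ▸ Nat.lt_succ_self _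
    | tail _ h ih => exact ih.trans (h.2 ▸ Nat.lt_succ_self _)
  exact fun x h => (this x x h).false

/-- The strategy of the timed process that ignores the time. -/
noncomputable def Strategy.toTimed (σ : M.Strategy) : M.timed.Strategy where
  act w x := (σ.act (w.map Prod.fst) ⟨x.1.1, x.2⟩).map fun t => (t, x.1.2 + 1)
  act_support w x y hy := by
    rw [PMF.mem_support_map_iff] at hy
    obtain ⟨t, ht, rfl⟩ := hy
    exact ⟨σ.act_support _ _ t ht, rfl⟩

/-- The strategy that simulates a strategy of the timed process. -/
noncomputable def Strategy.ofTimed (τ : M.timed.Strategy) : M.Strategy where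
  act w s := (τ.act w.zipIdx ⟨(s.1, w.length), s.2⟩).map Prod.fst
  act_support w s t ht := by
    rw [PMF.mem_support_map_iff] at ht
    obtain ⟨y, hy, rfl⟩ := ht
    exact (τ.act_support _ _ y hy).1

lemma Strategy.step_toTimed (σ : M.Strategy) (w : List S) (s : S) :
    σ.toTimed.step w.zipIdx (s, w.length) = (σ.step w s).map fun t => (t, w.length + 1) := by
  by_cases h : s ∈ M.controlled
  · rw [σ.step_of_controlled w h, Strategy.step_of_controlled _ _ (show (s, w.length) ∈ _ from h)]
    change PMF.map _ (σ.act (w.zipIdx.map Prod.fst) _) = _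
    rw [List.zipIdx_map_fst]
  · rw [σ.step_of_random w h, Strategy.step_of_random _ _ (show (s, w.length) ∉ _ from h)]
    rfl

/-- Timed histories starting at time 0 have the form `w.zipIdx`, so they carry no more information
than `w`. Projecting a timed move loses nothing either, since its clock is forced. -/
lemma Strategy.step_ofTimed (τ : M.timed.Strategy) (w : List S) (s : S) :
    τ.step w.zipIdx (s, w.length) = (τ.ofTimed.step w s).map fun t => (t, w.length + 1) := by
  by_cases h : s ∈ M.controlled
  · rw [Strategy.step_of_controlled _ w h,
      Strategy.step_of_controlled _ _ (show (s, w.length) ∈ _ from h)]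
    change _ = PMF.map _ (PMF.map _ _)
    rw [PMF.map_comp, map_eq_self_of_support]
    intro y hy
    exact Prod.ext rfl (τ.act_support _ _ y hy).2.symm
  · rw [Strategy.step_of_random _ w h, Strategy.step_of_random _ _ (show (s, w.length) ∉ _ from h)]
    rfl

variable [Countable S] [MeasurableSpace S] [DiscreteMeasurableSpace S]

/-- The law of a process whose states are annotated by the time. -/
lemma processLaw_timed {step : List S → S → PMF S} {step' : List (S × ℕ) → S × ℕ → PMF (S × ℕ)}
    (h : ∀ w s, step' w.zipIdx (s, w.length) = (step w s).map fun t => (t, w.length + 1)) (s : S) :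
    processLaw step' (s, 0) = (processLaw step s).map fun ρ n => (ρ n, n) := by
  classical
  have hm : Measurable fun (ρ : ℕ → S) (n : ℕ) => (ρ n, n) :=
    measurable_pi_lambda _ fun n => (measurable_pi_apply n).prodMk measurable_const
  have hP : IsProbabilityMeasure ((processLaw step s).map fun ρ n => (ρ n, n)) :=
    Measure.isProbabilityMeasure_map hm.aemeasurable
  have hmap : ∀ (x : ℕ → S × ℕ) n, (processLaw step s).map (fun ρ n => (ρ n, n))
      {ρ | ∀ i ≤ n, ρ i = x i} = if ∀ i ≤ n, (x i).2 = i then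
        processLaw step s {ρ | ∀ i ≤ n, ρ i = (x i).1} else 0 := by
    intro x n
    rw [Measure.map_apply hm (measurableSet_prefixSet x n)]
    split_ifs with hx
    · congr 1
      ext ρ
      refine forall₂_congr fun i hi => ?_
      rw [Prod.ext_iff]
      exact and_iff_left (hx i hi).symm
    · rw [← measure_empty (μ := processLaw step s)]
      congr 1
      refine Set.eq_empty_of_forall_notMem fun ρ hρ => hx fun i hi => ?_
      rw [← hρ i hi]
  refine (eq_processLaw (fun x => ?_) fun x n hx => ?_).symm
  · rw [hmap, processLaw_prefixSet_zero _ _ fun i => (x i).1]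
    simp only [Nat.le_zero, forall_eq, Prod.ext_iff]
    by_cases h1 : (x 0).1 = s <;> by_cases h2 : (x 0).2 = 0 <;> simp [h1, h2]
  · rw [hmap, hmap]
    -- Only prefixes whose clock shows the true time have mass; for all others both sides are zero.
    by_cases hn : ∀ i ≤ n, (x i).2 = i
    · have hw : (List.ofFn fun i : Fin n => x i) = (List.ofFn fun i : Fin n => (x i).1).zipIdx := by
        refine List.ext_getElem (by simp) fun i h1 h2 => ?_
        have hi : i < n := by simpa using h1
        simp only [List.getElem_ofFn, List.getElem_zipIdx, Nat.zero_add]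
        exact Prod.ext rfl (hn i hi.le)
      have hxn : x n = ((x n).1, (List.ofFn fun i : Fin n => (x i).1).length) := by
        rw [List.length_ofFn]
        exact Prod.ext rfl (hn n le_rfl)
      rw [if_pos hn, hw, hxn, h, map_prodMk_apply, List.length_ofFn]
      by_cases hn1 : (x (n + 1)).2 = n + 1
      · rw [if_pos, if_pos hn1, processLaw_prefixSet_succ _ _ fun i => (x i).1]
        intro i hi
        rcases Nat.le_succ_iff.1 hi with hi | rfl
        exacts [hn i hi, hn1]
      · rw [if_neg fun h' => hn1 (h' _ le_rfl), if_neg hn1, mul_zero]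
    · rw [if_neg hn, if_neg fun h' => hn fun i hi => h' i (by omega), zero_mul]

lemma runMeasure_timed {σ : M.Strategy} {τ : M.timed.Strategy}
    (h : ∀ w s, τ.step w.zipIdx (s, w.length) = (σ.step w s).map fun t => (t, w.length + 1))
    (col : S → ℕ) (s : S) :
    τ.runMeasure (s, 0) (parity fun x => col x.1) = σ.runMeasure s (parity col) := by
  rw [Strategy.runMeasure_eq_processLaw, Strategy.runMeasure_eq_processLaw, processLaw_timed h,
    Measure.map_apply _ (measurableSet_parity _)]
  · rfl
  · exact measurable_pi_lambda _ fun n => (measurable_pi_apply n).prodMk measurable_const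

/-- Strategies translate in both directions with the same winning probability, by `toTimed` and
`ofTimed`. This transfers optimality between the two processes, from initial states at time 0. -/
lemma value_timed (M : MDP S) (col : S → ℕ) (s : S) :
    M.timed.value (parity fun x => col x.1) (s, 0) = M.value (parity col) s := by
  refine le_antisymm (iSup_le fun τ => ?_) (iSup_le fun σ => ?_)
  · rw [runMeasure_timed τ.step_ofTimed]
    exact runMeasure_le_value _ _ _
  · rw [← runMeasure_timed σ.step_toTimed]
    exact runMeasure_le_value _ _ _

/-- A single deterministic Markov strategy is optimal for the `{0, 1, 2}`-parity objective from
every state that has an optimal strategy. -/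
theorem exists_markov_optimal (M : MDP S) (col : S → ℕ)
    (hcol : ∀ s, col s ∈ ({0, 1, 2} : Set ℕ)) :
    ∃ σ : M.Strategy, σ.IsMarkov ∧ σ.IsDeterministic ∧
      ∀ s ∈ M.optStates (parity col), σ.IsOptimalFrom (parity col) s := by
  obtain ⟨τ, ⟨u, hu⟩, hdet, hτ⟩ := exists_memoryless_optimal M.timed (fun x => col x.1)
    (fun x => hcol x.1) M.timed_acyclic
  refine ⟨τ.ofTimed, ⟨fun n s => (u ⟨(s.1, n), s.2⟩).map Prod.fst, fun w s => ?_⟩, fun w s => ?_,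
    fun s ⟨σ, hσ⟩ => ?_⟩
  · exact congrArg (PMF.map Prod.fst) (hu _ _)
  · obtain ⟨t, ht⟩ := hdet w.zipIdx ⟨(s.1, w.length), s.2⟩
    refine ⟨t.1, ?_⟩
    change PMF.map _ (τ.act w.zipIdx ⟨(s.1, w.length), s.2⟩) = _
    rw [ht, PMF.pure_map]
  · have hopt : (s, 0) ∈ M.timed.optStates (parity fun x => col x.1) := by
      refine ⟨σ.toTimed, ?_⟩
      rw [Strategy.IsOptimalFrom, value_timed, runMeasure_timed σ.step_toTimed]
      exact hσ
    have := hτ _ hopt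
    rwa [Strategy.IsOptimalFrom, value_timed, runMeasure_timed τ.step_ofTimed] at this

end Timed

end MDP

theorem mainTheorem6 {S : Type*} [Countable S] [MeasurableSpace S] [DiscreteMeasurableSpace S]
    (M : MDP S) (col : S → ℕ) (hcol : ∀ s, col s ∈ ({0, 1, 2} : Set ℕ)) :
    (M.Acyclic →
      ∃ σ : M.Strategy, σ.IsMemoryless ∧ σ.IsDeterministic ∧
        ∀ s ∈ M.optStates (MDP.parity col), σ.IsOptimalFrom (MDP.parity col) s) ∧
    (∃ σ : M.Strategy, σ.IsMarkov ∧ σ.IsDeterministic ∧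
        ∀ s ∈ M.optStates (MDP.parity col), σ.IsOptimalFrom (MDP.parity col) s) :=
  ⟨MDP.exists_memoryless_optimal M col hcol, MDP.exists_markov_optimal M col hcol⟩
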